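/- **Conventions.** A dcpo is a poset in which every nonempty directed subset has a supremum (no bottom is required), and maps between dcpos are continuous in the sense of Scott. For dcpos $X,Y$ let $Y^X$ be the dcpo of continuous maps $X\to Y$ with the pointwise order. A dcpo is continuous if each of its elements is the directed supremum of the elements way below it; it is compact if it is compact in its Scott topology. A *dcpo-algebra* is a dcpo with a continuous binary operation $\cup$; homomorphisms are the continuous maps preserving $\cup$, and $\hom(P,Q)$ is the dcpo of homomorphisms with the pointwise order. A *dcpo-semilattice* is a dcpo-algebra whose operation is idempotent, commutative and associative. Powers $P^X$ carry the pointwise operation; a dcpo-subsemilattice is a subset closed under $\cup$ and under directed suprema. The *Plotkin powerdomain* $\mathcal P(X)$ is the free dcpo-semilattice over the dcpo $X$: it comes with a continuous $\iota:X\to\mathcal P(X)$ such that every continuous map from $X$ to a dcpo-semilattice $B$ is $h\circ\iota$ for a unique homomorphism $h:\mathcal P(X)\to B$. Let $\mathbb A=\{\bot<m<\top\}$ with $a\cup a=a$ and $a\cup b=m$ for $a\neq b$ (Heckmann's semilattice). A homomorphism $e:P\to Q$ of dcpo-algebras (resp. a continuous map $e:Y\to Q$ from a dcpo to a dcpo-algebra)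 is *$C$-equable*, for a dcpo-algebra $C$, if $h\mapsto h\circ e$ is an isomorphism of dcpos $\hom(Q,C)\to\hom(P,C)$ (resp. $\hom(Q,C)\to C^Y$). A dcpo-algebra $C$ is *$\mathbb A$-complete* (resp. *weakly $\mathbb A$-complete*) if every $\mathbb A$-equable homomorphism (resp. every $\mathbb A$-equable continuous map from a dcpo to a dcpo-algebra) is $C$-equable. For a dcpo $X$ and $x\in X$ let $\eta_X(x)=(u\mapsto u(x))\in\mathbb A^{\mathbb A^X}$. The *$\mathbb A$-repletion* of $X$ is the least $\mathbb A$-complete (equivalently, the least weakly $\mathbb A$-complete) dcpo-subsemilattice of $\mathbb A^{\mathbb A^X}$ containing all $\eta_X(x)$, $x\in X$. Let $\hom_{0,1}(\mathbb A^X,\mathbb A)$ be the set of continuous semilattice homomorphisms $\mathbb A^X\to\mathbb A$ preserving bottom and top. **Theorem 4.3.** (a) For every compact continuous dcpo $X$, the dcpo-semilattice $\hom_{0,1}(\mathbb A^X,\mathbb A)$ is the $\mathbb A$-repletion of $X$: it is both the least $\mathbb A$-complete and the least weakly $\mathbb A$-complete dcpo-subsemilattice of $\mathbb A^{\mathbb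 A^X}$ containing all evaluations $\eta_X(x)$, $x\in X$. Moreover, for every continuous dcpo $X$, the elements of $\hom_{0,1}(\mathbb A^X,\mathbb A)$ correspond to the formal lenses of $X$, i.e. the pairs $(C,Q)$ with $C$ Scott-closed, $Q$ Scott-compact and saturated, and $C\cap Q\ne\emptyset$: there is an isomorphism of dcpo-semilattices from $\hom_{0,1}(\mathbb A^X,\mathbb A)$ onto the set of formal lenses, ordered by $(C,Q)\le(C',Q')\iff C\subseteq C'$ and $Q'\subseteq Q$, with operation $(C\cup C',Q\cup Q')$, under which $\varphi$ corresponds to the $(C,Q)$ such that for all $u\in\mathbb A^X$: $\varphi(u)\neq\bot$ iff $u(x)\ne\bot$ for some $x\in C$, and $\varphi(u)=\top$ iff $u(x)=\top$ for all $x\in Q$. (b) For every continuous dcpo $X$, the Plotkin powerdomain $\mathcal P(X)$ is isomorphic to the least dcpo-subsemilattice of $\mathbb A^{\mathbb A^X}$ containing all evaluations $\eta_X(x)$, $x\in X$. That is, this subsemilattice together with $\eta_X$ is a free dcpo-semilattice over $X$, and every free dcpo-semilattice $\iota:X\to P$ over $X$ is isomorphic to it by an isomorphism of dcpo-semilattices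 carrying $\iota$ to $\eta_X$. In general the Plotkin powerdomain is properly smaller than the repletion: there is a compact continuous dcpo $X$ for which the subsemilattice in (b) is properly contained in $\hom_{0,1}(\mathbb A^X,\mathbb A)$. -/

import Mathlib

universe u v w

namespace DomainTheory

/-! ### Dcpos and Scott-continuous maps -/

/-- A dcpo: every (nonempty) directed subset has a supremum. No bottom element is required, and
the empty poset is a dcpo. -/
class IsDcpo (X : Type u) [PartialOrder X] : Prop where
  exists_isLUB : ∀ d : Set X, d.Nonempty → DirectedOn (· ≤ ·) d → ∃ a, IsLUB d a

/-- The exponential `Y ^ X`: all Scott-continuous maps `X → Y`, with the pointwise order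
(inherited from `X → Y`). -/
abbrev ContMap (X : Type u) (Y : Type v) [PartialOrder X] [PartialOrder Y] : Type (max u v) :=
  {f : X → Y // ScottContinuous f}

/-- `x` is way below `y`. -/
def WayBelow {X : Type u} [PartialOrder X] (x y : X) : Prop :=
  ∀ d : Set X, d.Nonempty → DirectedOn (· ≤ ·) d → ∀ a, IsLUB d a → y ≤ a → ∃ z ∈ d, x ≤ z

/-- A continuous dcpo: every element is the directed supremum of the elements way below it. -/
def IsContinuousDcpo (X : Type u) [PartialOrder X] : Prop :=
  IsDcpo X ∧ ∀ x : X, {y | WayBelow y x}.Nonempty ∧ DirectedOn (· ≤ ·) {y | WayBelow y x} ∧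
    IsLUB {y | WayBelow y x} x

/-- `X` is compact in its Scott topology. -/
def ScottCompact (X : Type u) [PartialOrder X] : Prop :=
  @CompactSpace X (Topology.scott X Set.univ)

section ContMap

variable {X : Type u} {Y : Type v} {P : Type w} [PartialOrder X] [PartialOrder Y] [PartialOrder P]

theorem scottContinuous_comp {g : Y → P} {f : X → Y} (hg : ScottContinuous g)
    (hf : ScottContinuous f) : ScottContinuous (fun x => g (f x)) := by
  intro d hn hd a ha
  have h := hg (hn.image f) (directedOn_image.2 (hd.mono fun _ _ h => hf.monotone h)) (hf hn hd ha)
  rwa [Set.image_image] at h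

theorem ContMap.isLUB_of_forall {d : Set (ContMap X Y)} {u : ContMap X Y}
    (h : ∀ x, IsLUB ((fun f : ContMap X Y => f.1 x) '' d) (u.1 x)) : IsLUB d u := by
  constructor
  · intro f hf x
    exact (h x).1 ⟨f, hf, rfl⟩
  · intro g hg x
    refine (h x).2 ?_
    rintro _ ⟨f, hf, rfl⟩
    exact hg hf x

/-- Directed suprema in `Y ^ X` are computed pointwise. -/
theorem ContMap.exists_pointwise_sup [IsDcpo Y] {d : Set (ContMap X Y)} (hn : d.Nonempty)
    (hd : DirectedOn (· ≤ ·) d) :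
    ∃ u : ContMap X Y, ∀ x, IsLUB ((fun f : ContMap X Y => f.1 x) '' d) (u.1 x) := by
  have key : ∀ x, ∃ a, IsLUB ((fun f : ContMap X Y => f.1 x) '' d) a := by
    intro x
    refine IsDcpo.exists_isLUB _ (hn.image _) ?_
    rintro _ ⟨f, hf, rfl⟩ _ ⟨g, hg, rfl⟩
    obtain ⟨k, hk, hfk, hgk⟩ := hd f hf g hg
    exact ⟨k.1 x, ⟨k, hk, rfl⟩, hfk x, hgk x⟩
  choose s hs using key
  refine ⟨⟨s, ?_⟩, hs⟩
  intro D hDn hD a ha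
  constructor
  · rintro _ ⟨x, hx, rfl⟩
    refine (hs x).2 ?_
    rintro _ ⟨f, hf, rfl⟩
    exact (f.2.monotone (ha.1 hx)).trans ((hs a).1 ⟨f, hf, rfl⟩)
  · intro b hb
    refine (hs a).2 ?_
    rintro _ ⟨f, hf, rfl⟩
    refine (f.2 hDn hD ha).2 ?_
    rintro _ ⟨x, hx, rfl⟩
    exact ((hs x).1 ⟨f, hf, rfl⟩).trans (hb ⟨x, hx, rfl⟩)

theorem ContMap.isLUB_apply [IsDcpo Y] {d : Set (ContMap X Y)} (hn : d.Nonempty)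
    (hd : DirectedOn (· ≤ ·) d) {u : ContMap X Y} (hu : IsLUB d u) (x : X) :
    IsLUB ((fun f : ContMap X Y => f.1 x) '' d) (u.1 x) := by
  obtain ⟨s, hs⟩ := ContMap.exists_pointwise_sup hn hd
  rw [hu.unique (ContMap.isLUB_of_forall hs)]
  exact hs x

instance [IsDcpo Y] : IsDcpo (ContMap X Y) where
  exists_isLUB _ hn hd :=
    let ⟨s, hs⟩ := ContMap.exists_pointwise_sup hn hd
    ⟨s, ContMap.isLUB_of_forall hs⟩

theorem ContMap.scottContinuous_apply [IsDcpo Y] (x : X) :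
    ScottContinuous (fun f : ContMap X Y => f.1 x) :=
  fun _ hn hd _ hu => ContMap.isLUB_apply hn hd hu x

theorem ContMap.scottContinuous_of_apply {F : P → ContMap X Y}
    (h : ∀ x, ScottContinuous (fun p => (F p).1 x)) : ScottContinuous F := by
  intro d hn hd a ha
  refine ContMap.isLUB_of_forall fun x => ?_
  rw [Set.image_image]
  exact h x hn hd ha

/-- The constant map with value `y`. -/
def ContMap.const (X : Type u) {Y : Type v} [PartialOrder X] [PartialOrder Y] (y : Y) :
    ContMap X Y :=
  ⟨fun _ => y, ScottContinuous.const y⟩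

/-- The evaluation map `η : X → R ^ (R ^ X)`, `η x = (u ↦ u x)`. -/
def eval (X : Type u) (R : Type v) [PartialOrder X] [PartialOrder R] [IsDcpo R] :
    ContMap X (ContMap (ContMap X R) R) :=
  ⟨fun x => ⟨fun f => f.1 x, ContMap.scottContinuous_apply x⟩,
    ContMap.scottContinuous_of_apply fun f => f.2⟩

end ContMap

/-! ### Algebras: dcpos with a continuous binary operation -/

/-- A dcpo-algebra for the signature with a single binary operation symbol: a dcpo together with a
Scott-continuous binary operation, subject to no laws. -/
class DcpoAlgebra (A : Type u) [PartialOrder A] extends IsDcpo A where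
  op : A → A → A
  op_continuous : ScottContinuous (fun p : A × A => op p.1 p.2)

infixl:65 " ⋓ " => DcpoAlgebra.op

theorem scottContinuous_op {P : Type v} {A : Type u} [PartialOrder P] [PartialOrder A]
    [DcpoAlgebra A] {F G : P → A} (hF : ScottContinuous F) (hG : ScottContinuous G) :
    ScottContinuous (fun p => F p ⋓ G p) :=
  scottContinuous_comp (g := fun p : A × A => p.1 ⋓ p.2) DcpoAlgebra.op_continuous (hF.prodMk hG)

/-- The semilattice laws. A dcpo-semilattice is a dcpo-algebra satisfying them; the semilattice
operation need not be related to the order in any other way than by continuity. -/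
structure IsSemilattice (A : Type u) [PartialOrder A] [DcpoAlgebra A] : Prop where
  idem : ∀ a : A, a ⋓ a = a
  comm : ∀ a b : A, a ⋓ b = b ⋓ a
  assoc : ∀ a b c : A, a ⋓ (b ⋓ c) = (a ⋓ b) ⋓ c

/-- `hom(A, B)`: the Scott-continuous homomorphisms, ordered pointwise. -/
abbrev Hom (A : Type u) (B : Type v) [PartialOrder A] [PartialOrder B] [DcpoAlgebra A]
    [DcpoAlgebra B] : Type (max u v) :=
  {f : A → B // ScottContinuous f ∧ ∀ a b, f (a ⋓ b) = f a ⋓ f b}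

/-- The power `A ^ X` with the pointwise operation. -/
instance (X : Type u) (A : Type v) [PartialOrder X] [PartialOrder A] [DcpoAlgebra A] :
    DcpoAlgebra (ContMap X A) where
  op f g := ⟨fun x => f.1 x ⋓ g.1 x,
    scottContinuous_op f.2 g.2⟩
  op_continuous := ContMap.scottContinuous_of_apply fun x =>
    scottContinuous_op
      (scottContinuous_comp (g := fun f : ContMap X A => f.1 x) (f := Prod.fst)
        (ContMap.scottContinuous_apply x) ScottContinuous.fst)
      (scottContinuous_comp (g := fun f : ContMap X A => f.1 x) (f := Prod.snd)
        (ContMap.scottContinuous_apply x) ScottContinuous.snd)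

/-- A dcpo-subalgebra: a subset closed under the operation and under directed suprema (taken in the
ambient algebra). For a dcpo-semilattice these are the dcpo-subsemilattices. -/
@[ext]
structure SubAlgebra (E : Type u) [PartialOrder E] [DcpoAlgebra E] where
  carrier : Set E
  op_mem : ∀ a ∈ carrier, ∀ b ∈ carrier, a ⋓ b ∈ carrier
  sup_mem : ∀ d ⊆ carrier, d.Nonempty → DirectedOn (· ≤ ·) d → ∀ a, IsLUB d a → a ∈ carrier

namespace SubAlgebra

variable {E : Type u} [PartialOrder E] [DcpoAlgebra E]

/-- Subalgebras are ordered by inclusion. -/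
instance : PartialOrder (SubAlgebra E) :=
  PartialOrder.lift carrier fun _ _ h => SubAlgebra.ext h

theorem isLUB_coe (S : SubAlgebra E) {d : Set S.carrier} (hn : d.Nonempty)
    (hd : DirectedOn (· ≤ ·) d) {a : S.carrier} (ha : IsLUB d a) :
    IsLUB (Subtype.val '' d) a.1 := by
  have hd' : DirectedOn (· ≤ ·) (Subtype.val '' d) := by
    rintro _ ⟨x, hx, rfl⟩ _ ⟨y, hy, rfl⟩
    obtain ⟨z, hz, h1, h2⟩ := hd x hx y hy
    exact ⟨z.1, ⟨z, hz, rfl⟩, h1, h2⟩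
  obtain ⟨b, hb⟩ := IsDcpo.exists_isLUB _ (hn.image _) hd'
  have hbS : b ∈ S.carrier :=
    S.sup_mem _ (by rintro _ ⟨x, _, rfl⟩; exact x.2) (hn.image _) hd' b hb
  have hb' : IsLUB d (⟨b, hbS⟩ : S.carrier) :=
    ⟨fun x hx => hb.1 ⟨x, hx, rfl⟩, fun c hc => hb.2 (by rintro _ ⟨x, hx, rfl⟩; exact hc hx)⟩
  rw [ha.unique hb']
  exact hb

theorem scottContinuous_val (S : SubAlgebra E) :
    ScottContinuous (Subtype.val : S.carrier → E) :=
  fun _ hn hd _ ha => S.isLUB_coe hn hd ha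

theorem scottContinuous_of_val {P : Type w} [PartialOrder P] (S : SubAlgebra E)
    {F : P → S.carrier} (h : ScottContinuous (fun p => (F p).1)) : ScottContinuous F := by
  intro d hn hd a ha
  have := h hn hd ha
  refine ⟨?_, fun c hc => this.2 ?_⟩
  · rintro _ ⟨x, hx, rfl⟩
    exact this.1 ⟨x, hx, rfl⟩
  · rintro _ ⟨x, hx, rfl⟩
    exact hc ⟨x, hx, rfl⟩

/-- A subalgebra is an algebra with the induced order and operation. -/
instance (S : SubAlgebra E) : DcpoAlgebra S.carrier where
  exists_isLUB d hn hd := by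
    have hd' : DirectedOn (· ≤ ·) (Subtype.val '' d) := by
      rintro _ ⟨x, hx, rfl⟩ _ ⟨y, hy, rfl⟩
      obtain ⟨z, hz, h1, h2⟩ := hd x hx y hy
      exact ⟨z.1, ⟨z, hz, rfl⟩, h1, h2⟩
    obtain ⟨b, hb⟩ := IsDcpo.exists_isLUB _ (hn.image _) hd'
    exact ⟨⟨b, S.sup_mem _ (by rintro _ ⟨x, _, rfl⟩; exact x.2) (hn.image _) hd' b hb⟩,
      fun x hx => hb.1 ⟨x, hx, rfl⟩, fun c hc => hb.2 (by rintro _ ⟨x, hx, rfl⟩; exact hc hx)⟩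
  op a b := ⟨a.1 ⋓ b.1, S.op_mem _ a.2 _ b.2⟩
  op_continuous := S.scottContinuous_of_val <|
    scottContinuous_op (scottContinuous_comp S.scottContinuous_val ScottContinuous.fst)
      (scottContinuous_comp S.scottContinuous_val ScottContinuous.snd)

/-- The least subalgebra containing the set `s`: the intersection of all of them. -/
def generated (s : Set E) : SubAlgebra E where
  carrier := {a | ∀ S : SubAlgebra E, s ⊆ S.carrier → a ∈ S.carrier}
  op_mem a ha b hb S hS := S.op_mem a (ha S hS) b (hb S hS)
  sup_mem d hd hn hdir a ha S hS := S.sup_mem d (fun _ hx => hd hx S hS) hn hdir a ha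

/-- The corestriction of a continuous map to a subalgebra containing its image. -/
def corestrict {X : Type v} [PartialOrder X] (S : SubAlgebra E) (f : ContMap X E)
    (h : ∀ x, f.1 x ∈ S.carrier) : ContMap X S.carrier :=
  ⟨fun x => ⟨f.1 x, h x⟩, S.scottContinuous_of_val f.2⟩

end SubAlgebra

/-! ### Equable maps and complete algebras -/

/-- A homomorphism `e : A → B` is `C`-equable if restriction along `e` is an isomorphism of dcpos
from `hom(B, C)` onto `hom(A, C)`. -/
def Hom.IsEquable {A : Type u} {B : Type u} [PartialOrder A] [PartialOrder B] [DcpoAlgebra A]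
    [DcpoAlgebra B] (e : Hom A B) (C : Type v) [PartialOrder C] [DcpoAlgebra C] : Prop :=
  ∃ i : Hom B C ≃o Hom A C, ∀ (h : Hom B C) (a : A), (i h).1 a = h.1 (e.1 a)

/-- A continuous map `e : X → A` from a dcpo to an algebra is `C`-equable if restriction along `e`
is an isomorphism of dcpos from `hom(A, C)` onto `C ^ X`. -/
def ContMap.IsEquable {X : Type u} {A : Type u} [PartialOrder X] [PartialOrder A] [DcpoAlgebra A]
    (e : ContMap X A) (C : Type v) [PartialOrder C] [DcpoAlgebra C] : Prop :=
  ∃ i : Hom A C ≃o ContMap X C, ∀ (h : Hom A C) (x : X), (i h).1 x = h.1 (e.1 x)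

/-- `C` is `R`-complete: every `R`-equable homomorphism is `C`-equable. -/
def IsCompleteAlgebra (R : Type v) [PartialOrder R] [DcpoAlgebra R]
    (C : Type u) [PartialOrder C] [DcpoAlgebra C] : Prop :=
  ∀ (A B : Type u) [PartialOrder A] [PartialOrder B] [DcpoAlgebra A] [DcpoAlgebra B]
    (e : Hom A B), e.IsEquable R → e.IsEquable C

/-- `C` is weakly `R`-complete: every `R`-equable continuous map from a dcpo to an algebra is
`C`-equable. -/
def IsWeaklyCompleteAlgebra (R : Type v) [PartialOrder R] [DcpoAlgebra R]
    (C : Type u) [PartialOrder C] [DcpoAlgebra C] : Prop :=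
  ∀ (Y A : Type u) [PartialOrder Y] [PartialOrder A] [IsDcpo Y] [DcpoAlgebra A]
    (e : ContMap Y A), e.IsEquable R → e.IsEquable C

/-! ### Heckmann's semilattice -/

/-- The three-element chain `⊥ < m < ⊤`. -/
inductive Heckmann : Type
  | bot
  | m
  | top

namespace Heckmann

/-- The position in the chain. -/
def rank : Heckmann → ℕ
  | bot => 0
  | m => 1
  | top => 2

theorem rank_injective : Function.Injective rank := by
  intro a b h
  cases a <;> cases b <;> simp_all [rank]

instance : PartialOrder Heckmann := PartialOrder.lift rank rank_injective

theorem le_iff (a b : Heckmann) : a ≤ b ↔ rank a ≤ rank b := Iff.rfl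

/-- The semilattice operation: `a ∪ a = a`, and `a ∪ b = m` if `a ≠ b`. -/
def union : Heckmann → Heckmann → Heckmann
  | bot, bot => bot
  | top, top => top
  | _, _ => m

theorem union_mono {a b c d : Heckmann} (h : a ≤ c) (h' : b ≤ d) : union a b ≤ union c d := by
  rw [le_iff] at *
  cases a <;> cases b <;> cases c <;> cases d <;> simp_all [union, rank]

theorem exists_isGreatest (d : Set Heckmann) (hn : d.Nonempty) : ∃ a, IsGreatest d a := by
  by_cases h2 : top ∈ d
  · exact ⟨top, h2, fun b _ => by rw [le_iff]; cases b <;> simp [rank]⟩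
  by_cases h1 : m ∈ d
  · refine ⟨m, h1, fun b hb => ?_⟩
    rw [le_iff]
    cases b
    · simp [rank]
    · simp [rank]
    · exact absurd hb h2
  obtain ⟨x, hx⟩ := hn
  refine ⟨x, hx, fun b hb => ?_⟩
  cases x <;> cases b <;> first | exact le_rfl | contradiction

instance : DcpoAlgebra Heckmann where
  exists_isLUB d hn _ :=
    let ⟨a, ha⟩ := exists_isGreatest d hn
    ⟨a, ha.isLUB⟩
  op := union
  op_continuous := by
    intro D hn hD p hp
    obtain ⟨x, hx⟩ := exists_isGreatest (Prod.fst '' D) (hn.image _)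
    obtain ⟨y, hy⟩ := exists_isGreatest (Prod.snd '' D) (hn.image _)
    obtain ⟨⟨q, hq, hqx⟩, hx'⟩ := hx
    obtain ⟨⟨r, hr, hry⟩, hy'⟩ := hy
    obtain ⟨s, hs, hqs, hrs⟩ := hD q hq r hr
    have hsg : IsGreatest D s :=
      ⟨hs, fun t ht => ⟨(hx' ⟨t, ht, rfl⟩).trans (hqx ▸ hqs.1), (hy' ⟨t, ht, rfl⟩).trans (hry ▸ hrs.2)⟩⟩
    rw [hp.unique hsg.isLUB]
    refine IsGreatest.isLUB ⟨⟨s, hs, rfl⟩, ?_⟩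
    rintro _ ⟨t, ht, rfl⟩
    exact union_mono (hsg.2 ht).1 (hsg.2 ht).2

theorem op_eq (a b : Heckmann) : a ⋓ b = union a b := rfl

theorem isSemilattice : IsSemilattice Heckmann where
  idem a := by cases a <;> rfl
  comm a b := by cases a <;> cases b <;> rfl
  assoc a b c := by cases a <;> cases b <;> cases c <;> rfl

theorem op_op_op_comm (a b c d : Heckmann) : (a ⋓ b) ⋓ (c ⋓ d) = (a ⋓ c) ⋓ (b ⋓ d) := by
  cases a <;> cases b <;> cases c <;> cases d <;> rfl

end Heckmann

/-- `A ^ (A ^ X)` for Heckmann's semilattice `A`. -/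
abbrev DoublePower (X : Type u) [PartialOrder X] : Type u :=
  ContMap (ContMap X Heckmann) Heckmann

/-- `hom_{0,1}(A ^ X, A)`: all continuous semilattice homomorphisms `A ^ X → A` preserving bottom
and top (the constant functions are the bottom and the top of `A ^ X`), as a dcpo-subsemilattice
of `A ^ (A ^ X)`. -/
def hom01 (X : Type u) [PartialOrder X] : SubAlgebra (DoublePower X) where
  carrier := {φ | (∀ f g : ContMap X Heckmann, φ.1 (f ⋓ g) = φ.1 f ⋓ φ.1 g) ∧
    φ.1 (ContMap.const X Heckmann.bot) = Heckmann.bot ∧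
    φ.1 (ContMap.const X Heckmann.top) = Heckmann.top}
  op_mem φ hφ ψ hψ := by
    refine ⟨fun f g => ?_, ?_, ?_⟩
    · change φ.1 (f ⋓ g) ⋓ ψ.1 (f ⋓ g) = (φ.1 f ⋓ ψ.1 f) ⋓ (φ.1 g ⋓ ψ.1 g)
      rw [hφ.1, hψ.1, Heckmann.op_op_op_comm]
    · change φ.1 _ ⋓ ψ.1 _ = _
      rw [hφ.2.1, hψ.2.1]; rfl
    · change φ.1 _ ⋓ ψ.1 _ = _
      rw [hφ.2.2, hψ.2.2]; rfl
  sup_mem d hd hn hdir φ hφ := by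
    have hconst : ∀ (f : ContMap X Heckmann) (c : Heckmann), (∀ ψ ∈ d, ψ.1 f = c) → φ.1 f = c := by
      intro f c hc
      refine (ContMap.isLUB_apply hn hdir hφ f).unique ?_
      have : (fun ψ : DoublePower X => ψ.1 f) '' d = {c} := by
        obtain ⟨ψ, hψ⟩ := hn
        refine Set.eq_singleton_iff_unique_mem.2 ⟨⟨ψ, hψ, hc ψ hψ⟩, ?_⟩
        rintro _ ⟨χ, hχ, rfl⟩
        exact hc χ hχ
      rw [this]
      exact isLUB_singleton
    refine ⟨fun f g => ?_, hconst _ _ fun ψ hψ => (hd hψ).2.1, hconst _ _ fun ψ hψ => (hd hψ).2.2⟩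
    have h1 := ContMap.isLUB_apply hn hdir hφ (f ⋓ g)
    have h2 : IsLUB ((fun ψ : DoublePower X => ψ.1 f ⋓ ψ.1 g) '' d) (φ.1 f ⋓ φ.1 g) :=
      scottContinuous_op (ContMap.scottContinuous_apply f) (ContMap.scottContinuous_apply g) hn hdir hφ
    have h3 : (fun ψ : DoublePower X => ψ.1 (f ⋓ g)) '' d =
        (fun ψ : DoublePower X => ψ.1 f ⋓ ψ.1 g) '' d :=
      Set.image_congr fun ψ hψ => (hd hψ).1 f g
    rw [h3] at h1
    exact h1.unique h2

/-! ### Formal lenses -/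

/-- A formal lens: a Scott-closed set `C` and a Scott-compact saturated set `Q` that meet.
(The saturated sets of the Scott topology are the upper sets.) -/
@[ext]
structure FormalLens (X : Type u) [PartialOrder X] where
  C : Set X
  Q : Set X
  isClosed : @IsClosed X (Topology.scott X Set.univ) C
  isCompact : @IsCompact X (Topology.scott X Set.univ) Q
  saturated : IsUpperSet Q
  nonempty : (C ∩ Q).Nonempty

namespace FormalLens

variable {X : Type u} [PartialOrder X]

/-- `(C, Q) ≤ (C', Q')` means `C ⊆ C'` and `Q' ⊆ Q`. -/
instance : PartialOrder (FormalLens X) :=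
  PartialOrder.lift (fun L => ((L.C, OrderDual.toDual L.Q) : Set X × (Set X)ᵒᵈ)) fun _ _ h =>
    FormalLens.ext (congrArg Prod.fst h) (congrArg Prod.snd h)

/-- `(C, Q) ∪ (C', Q') = (C ∪ C', Q ∪ Q')`. -/
def union (L L' : FormalLens X) : FormalLens X where
  C := L.C ∪ L'.C
  Q := L.Q ∪ L'.Q
  isClosed := @IsClosed.union X _ _ (Topology.scott X Set.univ) L.isClosed L'.isClosed
  isCompact := @IsCompact.union X (Topology.scott X Set.univ) _ _ L.isCompact L'.isCompact
  saturated := L.saturated.union L'.saturated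
  nonempty := L.nonempty.mono
    (Set.inter_subset_inter Set.subset_union_left Set.subset_union_left)

/-- The formal lens `(C, Q)` corresponds to `φ` if, for every `f : X → A`, the value `φ f` is
different from `⊥` exactly when `f` is different from `⊥` somewhere on `C`, and equals `⊤` exactly
when `f` is `⊤` everywhere on `Q`. -/
def Represents (L : FormalLens X) (φ : DoublePower X) : Prop :=
  ∀ f : ContMap X Heckmann,
    (φ.1 f ≠ Heckmann.bot ↔ ∃ x ∈ L.C, f.1 x ≠ Heckmann.bot) ∧
    (φ.1 f = Heckmann.top ↔ ∀ x ∈ L.Q, f.1 x = Heckmann.top)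

end FormalLens

/-! ### The Plotkin powerdomain -/

/-- `ι : X → P` exhibits `P` as the Plotkin powerdomain of `X`, i.e. as the free dcpo-semilattice
over the dcpo `X`. -/
def IsPlotkinPowerdomain {X : Type u} {P : Type u} [PartialOrder X] [PartialOrder P]
    [DcpoAlgebra P] (ι : ContMap X P) : Prop :=
  IsSemilattice P ∧
  ∀ (B : Type u) [PartialOrder B] [DcpoAlgebra B], IsSemilattice B →
    ∀ f : ContMap X B, ∃! h : Hom P B, ∀ x, h.1 (ι.1 x) = f.1 x

/-- The least dcpo-subsemilattice of `A ^ (A ^ X)` containing the point evaluations. -/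
def evalSub (X : Type u) [PartialOrder X] : SubAlgebra (DoublePower X) :=
  SubAlgebra.generated (Set.range (eval X Heckmann).1)

theorem eval_mem_evalSub {X : Type u} [PartialOrder X] (x : X) :
    (eval X Heckmann).1 x ∈ (evalSub X).carrier :=
  fun _ hS => hS ⟨x, rfl⟩

/-- The point evaluations as a map into `evalSub X`. -/
def evalSubMap (X : Type u) [PartialOrder X] : ContMap X (evalSub X).carrier :=
  (evalSub X).corestrict (eval X Heckmann) eval_mem_evalSub

end DomainTheory

open DomainTheory

/-! An element `a` of Heckmann's semilattice is known from two bits, `a ≠ ⊥` and `a = ⊤`. The first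
bit of a union is the disjunction of the first bits, the second is the conjunction of the second
bits, and both bits commute with directed suprema. So a continuous map `X → A` is a pair of open
sets `V ⊆ U`, and most arguments run bit by bit.

Lenses. For `φ` in `hom01 X`, adding the constant `⊥` or `⊤` to a map isolates one bit, so `φ`
amounts to two predicates on open sets, `Meets` and `Inside`. `Meets` turns finite and directed
unions into disjunctions, hence there is a largest unmet open set; its complement is `C`. `Inside`
is a Scott-open filter, hence by Hofmann–Mislove (`IsContinuousDcpo.mem_of_forall_mem_filter`) it
consists of the open neighbourhoods of a compact saturated `Q`.

Repletion. `hom01 X` is cut out of a power of `A` by equations between `A`-valued evaluations, so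
maps into it extend along `A`-equable maps coordinate by coordinate (`exists_hom_hom01`).
Conversely, a homomorphism `h` from `hom01 X` to `A` is determined by its values at the points:
approximating a lens by finitely many points in `C` or around `Q` yields both bits of `h`
(`hom_hom01_apply`). Therefore `evalHom01` and the inclusion of `evalSub X` are `A`-equable, and
every (weakly) complete subalgebra containing the evaluations must contain `hom01 X`.

Powerdomain. The elements `φ` of `evalSub X` are those reached from points by unions and directed
suprema, and all of them are approximated by finite sets way below `φ` in the Egli–Milner sense
(`approximable_of_mem_evalSub`). A map `f` into a dcpo-semilattice extends by sending `φ` to the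
directed supremum of the finite joins of `f` over these sets. A lens whose `Q` has a point not above
any point of `C` need not be approximable; the two-point discrete order already provides one. -/

namespace DomainTheory

/-! ### Values in Heckmann's semilattice -/

namespace Heckmann

theorem le_iff_imp {a b : Heckmann} : a ≤ b ↔ (a ≠ bot → b ≠ bot) ∧ (a = top → b = top) := by
  rw [le_iff]
  cases a <;> cases b <;> simp [rank]

theorem eq_iff {a b : Heckmann} : a = b ↔ (a ≠ bot ↔ b ≠ bot) ∧ (a = top ↔ b = top) := by
  cases a <;> cases b <;> simp

theorem op_ne_bot {a b : Heckmann} : a ⋓ b ≠ bot ↔ a ≠ bot ∨ b ≠ bot := by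
  rw [op_eq]
  cases a <;> cases b <;> simp [union]

theorem op_eq_bot {a b : Heckmann} : a ⋓ b = bot ↔ a = bot ∧ b = bot := by
  rw [op_eq]
  cases a <;> cases b <;> simp [union]

theorem op_eq_top {a b : Heckmann} : a ⋓ b = top ↔ a = top ∧ b = top := by
  rw [op_eq]
  cases a <;> cases b <;> simp [union]

theorem le_top (a : Heckmann) : a ≤ top := by
  rw [le_iff]
  cases a <;> simp [rank]

theorem bot_le (a : Heckmann) : bot ≤ a := by
  rw [le_iff]
  cases a <;> simp [rank]

theorem eq_bot_of_le_bot {a : Heckmann} (h : a ≤ bot) : a = bot := le_antisymm h (bot_le a)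

theorem eq_top_of_top_le {a : Heckmann} (h : top ≤ a) : a = top := le_antisymm (le_top a) h

/-- A nonempty subset of a finite chain has a greatest element, which carries both bits of the
supremum. -/
theorem isLUB_iff {S : Set Heckmann} (hS : S.Nonempty) {a : Heckmann} :
    IsLUB S a ↔ (a ≠ bot ↔ ∃ b ∈ S, b ≠ bot) ∧ (a = top ↔ ∃ b ∈ S, b = top) := by
  obtain ⟨g, hg⟩ := exists_isGreatest S hS
  have key : (g ≠ bot ↔ ∃ b ∈ S, b ≠ bot) ∧ (g = top ↔ ∃ b ∈ S, b = top) :=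
    ⟨⟨fun h => ⟨g, hg.1, h⟩, fun ⟨_, hb, h⟩ => (le_iff_imp.1 (hg.2 hb)).1 h⟩,
      ⟨fun h => ⟨g, hg.1, h⟩, fun ⟨_, hb, h⟩ => (le_iff_imp.1 (hg.2 hb)).2 h⟩⟩
  constructor
  · intro h
    rwa [h.unique hg.isLUB]
  · intro h
    have : a = g := eq_iff.2 ⟨h.1.trans key.1.symm, h.2.trans key.2.symm⟩
    rw [this]
    exact hg.isLUB

end Heckmann

/-! ### The Scott topology -/

/-- The Scott topology of a poset. -/
abbrev scottTopology (X : Type u) [PartialOrder X] : TopologicalSpace X :=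
  Topology.scott X Set.univ

attribute [local instance] scottTopology

instance (X : Type u) [PartialOrder X] : @Topology.IsScott X Set.univ _ (scottTopology X) :=
  @Topology.IsScott.mk X Set.univ _ (scottTopology X) rfl

section Scott

variable {X : Type u} [PartialOrder X]

theorem isScottOpen_iff {U : Set X} : IsOpen U ↔ IsUpperSet U ∧ DirSupInacc U := by
  rw [Topology.IsScott.isOpen_iff_isUpperSet_and_dirSupInaccOn (D := Set.univ), dirSupInaccOn_univ]

theorem isUpperSet_of_isScottOpen {U : Set X} (h : IsOpen U) : IsUpperSet U :=
  (isScottOpen_iff.1 h).1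

theorem isLowerSet_of_isScottClosed {C : Set X} (h : IsClosed C) : IsLowerSet C :=
  Topology.IsScott.isLowerSet_of_isClosed h

theorem exists_mem_of_isLUB_mem {U : Set X} (h : IsOpen U) {d : Set X} (hn : d.Nonempty)
    (hd : DirectedOn (· ≤ ·) d) {a : X} (ha : IsLUB d a) (haU : a ∈ U) : ∃ x ∈ d, x ∈ U :=
  (isScottOpen_iff.1 h).2 hn hd ha haU

theorem isScottClosed_Iic (a : X) : IsClosed (Set.Iic a) :=
  Topology.IsScott.isClosed_iff_isLowerSet_and_dirSupClosed.2 ⟨isLowerSet_Iic _, dirSupClosed_Iic _⟩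

theorem scottContinuous_heckmann_iff {f : X → Heckmann} :
    ScottContinuous f ↔
      IsOpen {x | f x ≠ Heckmann.bot} ∧ IsOpen {x | f x = Heckmann.top} := by
  rw [isScottOpen_iff, isScottOpen_iff]
  constructor
  · intro hf
    have hlub {d : Set X} (hn : d.Nonempty) (hd : DirectedOn (· ≤ ·) d) {a : X} (ha : IsLUB d a) :=
      (Heckmann.isLUB_iff (hn.image f)).1 (hf hn hd ha)
    refine ⟨⟨fun x y hxy => (Heckmann.le_iff_imp.1 (hf.monotone hxy)).1, ?_⟩,
      ⟨fun x y hxy => (Heckmann.le_iff_imp.1 (hf.monotone hxy)).2, ?_⟩⟩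
    · intro d hn hd a ha hfa
      obtain ⟨_, ⟨x, hx, rfl⟩, h⟩ := (hlub hn hd ha).1.1 hfa
      exact ⟨x, hx, h⟩
    · intro d hn hd a ha hfa
      obtain ⟨_, ⟨x, hx, rfl⟩, h⟩ := (hlub hn hd ha).2.1 hfa
      exact ⟨x, hx, h⟩
  · rintro ⟨⟨hu, hi⟩, hu', hi'⟩ d hn hd a ha
    refine (Heckmann.isLUB_iff (hn.image f)).2 ⟨⟨fun h => ?_, ?_⟩, fun h => ?_, ?_⟩
    · obtain ⟨x, hx, h⟩ := hi hn hd ha h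
      exact ⟨f x, ⟨x, hx, rfl⟩, h⟩
    · rintro ⟨_, ⟨x, hx, rfl⟩, h⟩
      exact hu (ha.1 hx) h
    · obtain ⟨x, hx, h⟩ := hi' hn hd ha h
      exact ⟨f x, ⟨x, hx, rfl⟩, h⟩
    · rintro ⟨_, ⟨x, hx, rfl⟩, h⟩
      exact hu' (ha.1 hx) h

theorem ContMap.isOpen_ne_bot (f : ContMap X Heckmann) : IsOpen {x | f.1 x ≠ Heckmann.bot} :=
  (scottContinuous_heckmann_iff.1 f.2).1

theorem ContMap.isOpen_eq_top (f : ContMap X Heckmann) : IsOpen {x | f.1 x = Heckmann.top} :=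
  (scottContinuous_heckmann_iff.1 f.2).2

open Classical in
/-- The map with value `⊤` on the open set `V`, with value `m` on the rest of the open set `U`, and
with value `⊥` elsewhere. -/
noncomputable def ContMap.ofOpens (U V : TopologicalSpace.Opens X) : ContMap X Heckmann :=
  ⟨fun x => if x ∈ V then Heckmann.top else if x ∈ U then Heckmann.m else Heckmann.bot, by
    refine scottContinuous_heckmann_iff.2 ⟨?_, ?_⟩
    · convert (U ⊔ V).isOpen using 1
      ext x
      by_cases h : x ∈ V <;> by_cases h' : x ∈ U <;> simp [h, h']
    · convert V.isOpen using 1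
      ext x
      by_cases h : x ∈ V <;> by_cases h' : x ∈ U <;> simp [h, h']⟩

theorem ContMap.ofOpens_ne_bot {U V : TopologicalSpace.Opens X} {x : X} :
    (ContMap.ofOpens U V).1 x ≠ Heckmann.bot ↔ x ∈ U ∨ x ∈ V := by
  by_cases h : x ∈ V <;> by_cases h' : x ∈ U <;> simp [ContMap.ofOpens, h, h']

theorem ContMap.ofOpens_eq_top {U V : TopologicalSpace.Opens X} {x : X} :
    (ContMap.ofOpens U V).1 x = Heckmann.top ↔ x ∈ V := by
  by_cases h : x ∈ V <;> by_cases h' : x ∈ U <;> simp [ContMap.ofOpens, h, h']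

theorem ContMap.ext_heckmann {f g : ContMap X Heckmann}
    (h : ∀ x, f.1 x ≠ Heckmann.bot ↔ g.1 x ≠ Heckmann.bot)
    (h' : ∀ x, f.1 x = Heckmann.top ↔ g.1 x = Heckmann.top) : f = g :=
  Subtype.ext (funext fun x => Heckmann.eq_iff.2 ⟨h x, h' x⟩)

theorem ContMap.op_apply {A : Type v} [PartialOrder A] [DcpoAlgebra A] (f g : ContMap X A) (x : X) :
    (f ⋓ g).1 x = f.1 x ⋓ g.1 x := rfl

end Scott

/-! ### The way-below relation -/

section WayBelow

variable {X : Type u} [PartialOrder X]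

theorem WayBelow.le {x y : X} (h : WayBelow x y) : x ≤ y := by
  obtain ⟨z, rfl, hz⟩ := h {y} (Set.singleton_nonempty y) (directedOn_singleton _) y
    isLUB_singleton le_rfl
  exact hz

theorem WayBelow.trans_le {x y z : X} (h : WayBelow x y) (h' : y ≤ z) : WayBelow x z :=
  fun d hn hd a ha hza => h d hn hd a ha (h'.trans hza)

theorem WayBelow.of_le {x y z : X} (h : x ≤ y) (h' : WayBelow y z) : WayBelow x z :=
  fun d hn hd a ha hza =>
    let ⟨w, hw, hyw⟩ := h' d hn hd a ha hza
    ⟨w, hw, h.trans hyw⟩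

variable (hX : IsContinuousDcpo X)
include hX

/-- Interpolation: the elements two way-below steps under `y` are directed with supremum `y`, so one
of them lies above `x`. -/
theorem IsContinuousDcpo.exists_between {x y : X} (h : WayBelow x y) :
    ∃ z, WayBelow x z ∧ WayBelow z y := by
  have hn : {w | ∃ z, WayBelow w z ∧ WayBelow z y}.Nonempty := by
    obtain ⟨z, hz⟩ := (hX.2 y).1
    obtain ⟨w, hw⟩ := (hX.2 z).1
    exact ⟨w, z, hw, hz⟩
  have hd : DirectedOn (· ≤ ·) {w | ∃ z, WayBelow w z ∧ WayBelow z y} := by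
    rintro w₁ ⟨z₁, hw₁, hz₁⟩ w₂ ⟨z₂, hw₂, hz₂⟩
    obtain ⟨z, hz, h₁, h₂⟩ := (hX.2 y).2.1 z₁ hz₁ z₂ hz₂
    obtain ⟨w, hw, h₁', h₂'⟩ := (hX.2 z).2.1 w₁ (hw₁.trans_le h₁) w₂ (hw₂.trans_le h₂)
    exact ⟨w, ⟨z, hw, hz⟩, h₁', h₂'⟩
  have hl : IsLUB {w | ∃ z, WayBelow w z ∧ WayBelow z y} y := by
    refine ⟨fun w ⟨z, hw, hz⟩ => hw.le.trans hz.le, fun b hb => (hX.2 y).2.2.2 fun z hz => ?_⟩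
    exact (hX.2 z).2.2.2 fun w hw => hb ⟨z, hw, hz⟩
  obtain ⟨w, ⟨z, hw, hz⟩, hxw⟩ := h _ hn hd y hl le_rfl
  exact ⟨z, WayBelow.of_le hxw hw, hz⟩

theorem IsContinuousDcpo.isOpen_wayAbove (x : X) : IsOpen {y | WayBelow x y} := by
  refine isScottOpen_iff.2 ⟨fun y z hyz hy => WayBelow.trans_le hy hyz, ?_⟩
  intro d hn hd a ha hxa
  obtain ⟨z, hxz, hza⟩ := hX.exists_between hxa
  obtain ⟨w, hw, hzw⟩ := hza d hn hd a ha le_rfl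
  exact ⟨w, hw, WayBelow.trans_le hxz hzw⟩

theorem IsContinuousDcpo.exists_wayBelow_mem {U : Set X} (hU : IsOpen U) {x : X} (hx : x ∈ U) :
    ∃ y ∈ U, WayBelow y x :=
  let ⟨y, hy, hyU⟩ := exists_mem_of_isLUB_mem hU (hX.2 x).1 (hX.2 x).2.1 (hX.2 x).2.2 hx
  ⟨y, hyU, hy⟩

theorem IsContinuousDcpo.exists_finset_of_isCompact {K V : Set X} (hK : IsCompact K)
    (hV : IsOpen V) (hKV : K ⊆ V) :
    ∃ F : Finset X, (∀ z ∈ F, z ∈ V) ∧ ∀ x ∈ K, ∃ z ∈ F, WayBelow z x := by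
  classical
  obtain ⟨t, ht⟩ := hK.elim_finite_subcover (fun z : V => {y | WayBelow z.1 y})
    (fun z => hX.isOpen_wayAbove z.1) fun x hx => by
      obtain ⟨z, hzV, hz⟩ := hX.exists_wayBelow_mem hV (hKV hx)
      exact Set.mem_iUnion.2 ⟨⟨z, hzV⟩, hz⟩
  refine ⟨t.image Subtype.val, fun z hz => ?_, fun x hx => ?_⟩
  · obtain ⟨z, _, rfl⟩ := Finset.mem_image.1 hz
    exact z.2
  · obtain ⟨z, hz, hzx⟩ := Set.mem_iUnion₂.1 (ht hx)
    exact ⟨z, Finset.mem_image_of_mem _ hz, hzx⟩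

/-- Continuous dcpos are sober: a nonempty irreducible closed set is the closure of a point. -/
theorem IsContinuousDcpo.exists_eq_Iic {K : Set X} (hK : IsClosed K) (hn : K.Nonempty)
    (hirr : ∀ U V : Set X, IsOpen U → IsOpen V → (K ∩ U).Nonempty → (K ∩ V).Nonempty →
      (K ∩ (U ∩ V)).Nonempty) : ∃ s, K = Set.Iic s := by
  have := hX.1
  have hlow := isLowerSet_of_isScottClosed hK
  have hDn : {z | ∃ x ∈ K, WayBelow z x}.Nonempty := by
    obtain ⟨x, hx⟩ := hn
    obtain ⟨z, hz⟩ := (hX.2 x).1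
    exact ⟨z, x, hx, hz⟩
  have hDd : DirectedOn (· ≤ ·) {z | ∃ x ∈ K, WayBelow z x} := by
    rintro z₁ ⟨x₁, hx₁, hz₁⟩ z₂ ⟨x₂, hx₂, hz₂⟩
    -- Irreducibility replaces `x₁` and `x₂` by a single point of `K` that both `z₁` and `z₂` are
    -- way below.
    obtain ⟨x, hx, h₁, h₂⟩ := hirr _ _ (hX.isOpen_wayAbove z₁) (hX.isOpen_wayAbove z₂)
      ⟨x₁, hx₁, hz₁⟩ ⟨x₂, hx₂, hz₂⟩
    obtain ⟨z, hz, h₁', h₂'⟩ := (hX.2 x).2.1 z₁ h₁ z₂ h₂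
    exact ⟨z, ⟨x, hx, hz⟩, h₁', h₂'⟩
  obtain ⟨s, hs⟩ := IsDcpo.exists_isLUB _ hDn hDd
  refine ⟨s, Set.Subset.antisymm (fun x hx => ?_) fun x hx => hlow hx ?_⟩
  · exact (hX.2 x).2.2.2 fun z hz => hs.1 ⟨x, hx, hz⟩
  · refine Topology.IsScott.dirSupClosed_of_isClosed hK ?_ hDn hDd hs
    rintro z ⟨y, hy, hz⟩
    exact hlow hz.le hy

end WayBelow

/-! ### Open filters and compact saturated sets -/

section HofmannMislove

variable {X : Type u} [PartialOrder X]

open TopologicalSpace (Opens)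

/-- Hofmann–Mislove theorem: a Scott-open filter `T` of open sets of a continuous dcpo consists of
all open neighbourhoods of the intersection of its members. -/
theorem IsContinuousDcpo.mem_of_forall_mem_filter (hX : IsContinuousDcpo X) (T : Opens X → Prop)
    (hmono : ∀ U V, U ≤ V → T U → T V) (hinf : ∀ U V, T U → T V → T (U ⊓ V)) (htop : T ⊤)
    (hacc : ∀ S : Set (Opens X), S.Nonempty → DirectedOn (· ≤ ·) S → T (sSup S) → ∃ U ∈ S, T U)
    {V : Opens X} (hV : ∀ x, (∀ U, T U → x ∈ U) → x ∈ V) : T V := by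
  by_contra hTV
  -- Scott-openness of `T` keeps the union of a chain outside `T`, so there is a maximal open `W ⊇
  -- V` outside `T`. Maximality and the filter property make its complement irreducible, hence of
  -- the form `Set.Iic s`.
  obtain ⟨W, hVW, hW⟩ := zorn_le_nonempty₀ {W : Opens X | ¬ T W} (fun c hc hch y hy =>
    ⟨sSup c, fun h => by
      obtain ⟨U, hU, hTU⟩ := hacc c ⟨y, hy⟩ hch.directedOn h
      exact hc hU hTU, fun z hz => le_sSup hz⟩) V hTV
  have hnW : ¬ T W := hW.1
  have hbig : ∀ U : Opens X, ((Wᶜ : Set X) ∩ U).Nonempty → T (W ⊔ U) := by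
    rintro U ⟨x, hxW, hxU⟩
    by_contra h
    exact hxW (hW.2 h le_sup_left (show x ∈ W ⊔ U from Or.inr hxU))
  obtain ⟨s, hs⟩ := hX.exists_eq_Iic (K := (Wᶜ : Set X)) W.isOpen.isClosed_compl (by
    by_contra h
    rw [Set.not_nonempty_iff_eq_empty, Set.compl_empty_iff] at h
    exact hnW (by rwa [show W = ⊤ from TopologicalSpace.Opens.ext h])) (by
    intro U₁ U₂ h₁ h₂ hn₁ hn₂
    by_contra h
    refine hnW (hmono _ _ ?_ (hinf _ _ (hbig ⟨U₁, h₁⟩ hn₁) (hbig ⟨U₂, h₂⟩ hn₂)))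
    rintro x ⟨hx₁, hx₂⟩
    by_contra hxW
    rcases hx₁ with hx₁ | hx₁
    · exact hxW hx₁
    rcases hx₂ with hx₂ | hx₂
    · exact hxW hx₂
    exact h ⟨x, hxW, hx₁, hx₂⟩)
  have hsW : s ∉ W := by
    have : s ∈ (Wᶜ : Set X) := hs ▸ Set.mem_Iic.2 le_rfl
    exact this
  -- A member `U` of `T` omitting `s` would, being an upper set, omit all of `Set.Iic s`; then `U ≤
  -- W` would put `W` in `T`.
  refine hsW (hVW (hV s fun U hU => ?_))
  by_contra hsU
  refine hnW (hmono _ _ (fun x hxU => ?_) hU)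
  by_contra hxW
  have hx : x ∈ Set.Iic s := hs ▸ (show x ∈ (Wᶜ : Set X) from hxW)
  exact hsU (isUpperSet_of_isScottOpen U.isOpen hx hxU)

/-- A saturated set is the intersection of its open neighbourhoods. -/
theorem isUpperSet_subset_iff_of_isOpen {Q Q' : Set X} (hQ : IsUpperSet Q) :
    Q' ⊆ Q ↔ ∀ U : Opens X, Q ⊆ U → Q' ⊆ U := by
  refine ⟨fun h U hU => h.trans hU, fun h x hx => ?_⟩
  by_contra hxQ
  refine h ⟨(Set.Iic x)ᶜ, (isScottClosed_Iic x).isOpen_compl⟩ ?_ hx (Set.mem_Iic.2 le_rfl)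
  exact fun y hy hyx => hxQ (hQ hyx hy)

end HofmannMislove

/-! ### Formal lenses and homomorphisms -/

theorem isSemilattice_contMap {X : Type u} {A : Type v} [PartialOrder X] [PartialOrder A]
    [DcpoAlgebra A] (hA : IsSemilattice A) : IsSemilattice (ContMap X A) where
  idem f := Subtype.ext (funext fun x => hA.idem (f.1 x))
  comm f g := Subtype.ext (funext fun x => hA.comm (f.1 x) (g.1 x))
  assoc f g h := Subtype.ext (funext fun x => hA.assoc (f.1 x) (g.1 x) (h.1 x))

theorem isSemilattice_subAlgebra {E : Type u} [PartialOrder E] [DcpoAlgebra E]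
    (hE : IsSemilattice E) (S : SubAlgebra E) : IsSemilattice S.carrier where
  idem a := Subtype.ext (hE.idem a.1)
  comm a b := Subtype.ext (hE.comm a.1 b.1)
  assoc a b c := Subtype.ext (hE.assoc a.1 b.1 c.1)

section Lens

variable {X : Type u} [PartialOrder X]

open TopologicalSpace (Opens)

theorem eval_mem_hom01 (x : X) : (eval X Heckmann).1 x ∈ (hom01 X).carrier :=
  ⟨fun _ _ => rfl, rfl, rfl⟩

theorem evalSub_le_hom01 (X : Type u) [PartialOrder X] : evalSub X ≤ hom01 X := by
  intro φ hφ
  refine hφ (hom01 X) ?_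
  rintro _ ⟨x, rfl⟩
  exact eval_mem_hom01 x

/-- Directed suprema in `A ^ Y` in terms of the values of the maps. -/
theorem DoublePower.isLUB_iff {φ : DoublePower X} {d : Set (DoublePower X)} (hn : d.Nonempty)
    (hd : DirectedOn (· ≤ ·) d) :
    IsLUB d φ ↔ ∀ f, (φ.1 f ≠ Heckmann.bot ↔ ∃ ψ ∈ d, ψ.1 f ≠ Heckmann.bot) ∧
      (φ.1 f = Heckmann.top ↔ ∃ ψ ∈ d, ψ.1 f = Heckmann.top) := by
  have h : IsLUB d φ ↔ ∀ f, IsLUB ((fun ψ : DoublePower X => ψ.1 f) '' d) (φ.1 f) :=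
    ⟨fun h f => ContMap.isLUB_apply hn hd h f, ContMap.isLUB_of_forall⟩
  rw [h]
  refine forall_congr' fun f => ?_
  rw [Heckmann.isLUB_iff (hn.image _)]
  simp only [Set.exists_mem_image]

namespace FormalLens

theorem le_iff {L L' : FormalLens X} : L ≤ L' ↔ L.C ⊆ L'.C ∧ L'.Q ⊆ L.Q := Iff.rfl

open Classical in
/-- The value at `f` of the homomorphism `A ^ X → A` given by a formal lens. -/
noncomputable def value (L : FormalLens X) (f : ContMap X Heckmann) : Heckmann :=
  if ∀ x ∈ L.Q, f.1 x = Heckmann.top then Heckmann.top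
  else if ∃ x ∈ L.C, f.1 x ≠ Heckmann.bot then Heckmann.m else Heckmann.bot

theorem value_ne_bot (L : FormalLens X) (f : ContMap X Heckmann) :
    L.value f ≠ Heckmann.bot ↔ ∃ x ∈ L.C, f.1 x ≠ Heckmann.bot := by
  unfold value
  split_ifs with h h'
  · obtain ⟨x, hxC, hxQ⟩ := L.nonempty
    simp only [ne_eq, reduceCtorEq, not_false_eq_true, true_iff]
    exact ⟨x, hxC, by simp [h x hxQ]⟩
  · simpa using h'
  · simpa using h'

theorem value_eq_top (L : FormalLens X) (f : ContMap X Heckmann) :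
    L.value f = Heckmann.top ↔ ∀ x ∈ L.Q, f.1 x = Heckmann.top := by
  unfold value
  split_ifs with h h' <;> simpa using h

theorem scottContinuous_value (L : FormalLens X) : ScottContinuous L.value := by
  intro D hn hd f hf
  have hx (x : X) := (Heckmann.isLUB_iff (hn.image _)).1 (ContMap.isLUB_apply hn hd hf x)
  simp only [Set.exists_mem_image] at hx
  rw [Heckmann.isLUB_iff (hn.image _)]
  simp only [Set.exists_mem_image, value_ne_bot, value_eq_top]
  refine ⟨⟨fun ⟨x, hxC, h⟩ => ?_, fun ⟨g, hg, x, hxC, h⟩ => ⟨x, hxC, (hx x).1.2 ⟨g, hg, h⟩⟩⟩, ?_,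
    fun ⟨g, hg, h⟩ x hxQ => (hx x).2.2 ⟨g, hg, h x hxQ⟩⟩
  · obtain ⟨g, hg, h⟩ := (hx x).1.1 h
    exact ⟨g, hg, x, hxC, h⟩
  · intro h
    have := hn.to_subtype
    -- The sets where the members of `D` are `⊤` form a directed open cover of `Q`, so compactness
    -- lets one of them suffice.
    obtain ⟨g, hg⟩ := L.isCompact.elim_directed_cover
      (fun g : D => {x | g.1.1 x = Heckmann.top}) (fun g => g.1.isOpen_eq_top)
      (fun x hxQ => by
        obtain ⟨g, hg, h⟩ := (hx x).2.1 (h x hxQ)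
        exact Set.mem_iUnion.2 ⟨⟨g, hg⟩, h⟩)
      (fun g₁ g₂ => by
        obtain ⟨g, hg, h₁, h₂⟩ := hd g₁ g₁.2 g₂ g₂.2
        exact ⟨⟨g, hg⟩, fun x h => (Heckmann.le_iff_imp.1 (h₁ x)).2 h,
          fun x h => (Heckmann.le_iff_imp.1 (h₂ x)).2 h⟩)
    exact ⟨g.1, g.2, fun x hxQ => hg hxQ⟩

/-- The element of `A ^ (A ^ X)` given by a formal lens. -/
noncomputable def toDoublePower (L : FormalLens X) : DoublePower X :=
  ⟨L.value, L.scottContinuous_value⟩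

theorem represents_toDoublePower (L : FormalLens X) : L.Represents L.toDoublePower :=
  fun f => ⟨L.value_ne_bot f, L.value_eq_top f⟩

theorem Represents.mem_hom01 {L : FormalLens X} {φ : DoublePower X} (h : L.Represents φ) :
    φ ∈ (hom01 X).carrier := by
  obtain ⟨x, hxC, hxQ⟩ := L.nonempty
  refine ⟨fun f g => Heckmann.eq_iff.2 ⟨?_, ?_⟩, ?_, (h _).2.2 fun _ _ => rfl⟩
  · simp only [Heckmann.op_ne_bot, (h _).1, ContMap.op_apply]
    grind
  · simp only [Heckmann.op_eq_top, (h _).2, ContMap.op_apply]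
    grind
  · by_contra hc
    obtain ⟨y, _, hy⟩ := (h _).1.1 hc
    exact hy rfl

/-- Each inclusion is detected by test maps: the value `m` off `L'.C` tests `L.C ⊆ L'.C`, and the
value `⊤` on an open neighbourhood of `L.Q`, `m` elsewhere, tests `L'.Q ⊆ L.Q`, because a saturated
set is the intersection of its open neighbourhoods. -/
theorem Represents.le_iff {L L' : FormalLens X} {φ φ' : DoublePower X} (h : L.Represents φ)
    (h' : L'.Represents φ') : φ ≤ φ' ↔ L ≤ L' := by
  rw [FormalLens.le_iff]
  constructor
  · intro hle
    refine ⟨fun x hx => ?_, (isUpperSet_subset_iff_of_isOpen L.saturated).2 fun U hU x hx => ?_⟩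
    · by_contra hx'
      have hf := (Heckmann.le_iff_imp.1 (hle (ContMap.ofOpens ⟨L'.Cᶜ, L'.isClosed.isOpen_compl⟩ ⊥))).1
        ((h _).1.2 ⟨x, hx, ContMap.ofOpens_ne_bot.2 (Or.inl hx')⟩)
      obtain ⟨y, hy, hyf⟩ := (h' _).1.1 hf
      rcases ContMap.ofOpens_ne_bot.1 hyf with hy' | hy'
      · exact hy' hy
      · exact hy'
    · have hf := (Heckmann.le_iff_imp.1 (hle (ContMap.ofOpens ⊤ U))).2
        ((h _).2.2 fun y hy => ContMap.ofOpens_eq_top.2 (hU hy))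
      exact ContMap.ofOpens_eq_top.1 ((h' _).2.1 hf x hx)
  · rintro ⟨hC, hQ⟩ f
    refine Heckmann.le_iff_imp.2 ⟨fun hf => ?_, fun hf => ?_⟩
    · obtain ⟨x, hx, hxf⟩ := (h f).1.1 hf
      exact (h' f).1.2 ⟨x, hC hx, hxf⟩
    · exact (h' f).2.2 fun x hx => (h f).2.1 hf x (hQ hx)

theorem Represents.unique {L L' : FormalLens X} {φ : DoublePower X} (h : L.Represents φ)
    (h' : L'.Represents φ) : L = L' :=
  le_antisymm ((h.le_iff h').1 le_rfl) ((h'.le_iff h).1 le_rfl)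

theorem Represents.op {L L' : FormalLens X} {φ φ' : DoublePower X} (h : L.Represents φ)
    (h' : L'.Represents φ') : (L.union L').Represents (φ ⋓ φ') := by
  intro f
  rw [ContMap.op_apply, Heckmann.op_ne_bot, Heckmann.op_eq_top, (h f).1, (h' f).1, (h f).2,
    (h' f).2]
  simp only [union, Set.mem_union]
  grind

/-- The formal lens of a point. -/
def point (x : X) : FormalLens X where
  C := Set.Iic x
  Q := Set.Ici x
  isClosed := isScottClosed_Iic x
  isCompact := isCompact_of_finite_subcover fun U hU h => by
    obtain ⟨i, hi⟩ := Set.mem_iUnion.1 (h (Set.mem_Ici.2 le_rfl))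
    exact ⟨{i}, by simpa using (isUpperSet_of_isScottOpen (hU i)).Ici_subset hi⟩
  saturated := isUpperSet_Ici x
  nonempty := ⟨x, le_rfl, le_rfl⟩

theorem represents_point (x : X) : (point x).Represents ((eval X Heckmann).1 x) := by
  intro f
  change (f.1 x ≠ _ ↔ _) ∧ (f.1 x = _ ↔ _)
  refine ⟨⟨fun h => ⟨x, le_rfl, h⟩, ?_⟩, fun h y hy => ?_, fun h => h x le_rfl⟩
  · rintro ⟨y, hy, h⟩
    exact (Heckmann.le_iff_imp.1 (f.2.monotone hy)).1 h
  · exact (Heckmann.le_iff_imp.1 (f.2.monotone hy)).2 h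

end FormalLens

/-- The open set where a map is not `⊥`. -/
def ContMap.neBot (f : ContMap X Heckmann) : Opens X := ⟨_, f.isOpen_ne_bot⟩

/-- The open set where a map is `⊤`. -/
def ContMap.eqTop (f : ContMap X Heckmann) : Opens X := ⟨_, f.isOpen_eq_top⟩

theorem ContMap.ofOpens_mono {U U' V V' : Opens X} (hU : U ≤ U') (hV : V ≤ V') :
    ContMap.ofOpens U V ≤ ContMap.ofOpens U' V' := by
  intro x
  rw [Heckmann.le_iff_imp, ContMap.ofOpens_ne_bot, ContMap.ofOpens_ne_bot,
    ContMap.ofOpens_eq_top, ContMap.ofOpens_eq_top]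
  exact ⟨Or.imp (fun h => hU h) (fun h => hV h), fun h => hV h⟩

/-! ### The two predicates on open sets attached to an element of the double power -/

namespace DoublePower

/-- `φ` meets the open set `U` if it is not `⊥` at the map with value `m` on `U` and `⊥`
elsewhere. For `φ` given by a formal lens `(C, Q)` this says that `C` meets `U`. -/
def Meets (φ : DoublePower X) (U : Opens X) : Prop :=
  φ.1 (ContMap.ofOpens U ⊥) ≠ Heckmann.bot

/-- `φ` is inside the open set `V` if it is `⊤` at the map with value `⊤` on `V` and `m` elsewhere.
For `φ` given by a formal lens `(C, Q)` this says that `Q ⊆ V`. -/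
def Inside (φ : DoublePower X) (V : Opens X) : Prop :=
  φ.1 (ContMap.ofOpens ⊤ V) = Heckmann.top

theorem Meets.mono {φ ψ : DoublePower X} {U V : Opens X} (h : φ.Meets U) (hφ : φ ≤ ψ)
    (hUV : U ≤ V) : ψ.Meets V :=
  (Heckmann.le_iff_imp.1 ((hφ _).trans (ψ.2.monotone (ContMap.ofOpens_mono hUV le_rfl)))).1 h

theorem Inside.mono {φ ψ : DoublePower X} {U V : Opens X} (h : φ.Inside U) (hφ : φ ≤ ψ)
    (hUV : U ≤ V) : ψ.Inside V :=
  (Heckmann.le_iff_imp.1 ((hφ _).trans (ψ.2.monotone (ContMap.ofOpens_mono le_rfl hUV)))).2 h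

theorem meets_op {φ ψ : DoublePower X} {U : Opens X} :
    (φ ⋓ ψ).Meets U ↔ φ.Meets U ∨ ψ.Meets U := Heckmann.op_ne_bot

theorem inside_op {φ ψ : DoublePower X} {V : Opens X} :
    (φ ⋓ ψ).Inside V ↔ φ.Inside V ∧ ψ.Inside V := Heckmann.op_eq_top

theorem meets_eval {x : X} {U : Opens X} : Meets ((eval X Heckmann).1 x) U ↔ x ∈ U :=
  ContMap.ofOpens_ne_bot.trans (or_iff_left (fun h : x ∈ (⊥ : Opens X) => h))

theorem inside_eval {x : X} {V : Opens X} : Inside ((eval X Heckmann).1 x) V ↔ x ∈ V :=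
  ContMap.ofOpens_eq_top

theorem meets_of_isLUB {d : Set (DoublePower X)} (hn : d.Nonempty) (hd : DirectedOn (· ≤ ·) d)
    {φ : DoublePower X} (hφ : IsLUB d φ) {U : Opens X} : φ.Meets U ↔ ∃ ψ ∈ d, ψ.Meets U :=
  ((DoublePower.isLUB_iff hn hd).1 hφ _).1

theorem inside_of_isLUB {d : Set (DoublePower X)} (hn : d.Nonempty) (hd : DirectedOn (· ≤ ·) d)
    {φ : DoublePower X} (hφ : IsLUB d φ) {V : Opens X} : φ.Inside V ↔ ∃ ψ ∈ d, ψ.Inside V :=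
  ((DoublePower.isLUB_iff hn hd).1 hφ _).2

theorem Inside.exists_of_sSup {φ : DoublePower X} {S : Set (Opens X)} (hn : S.Nonempty)
    (hd : DirectedOn (· ≤ ·) S) (h : φ.Inside (sSup S)) : ∃ U ∈ S, φ.Inside U := by
  have hlub : IsLUB ((fun V => ContMap.ofOpens ⊤ V) '' S) (ContMap.ofOpens ⊤ (sSup S)) := by
    refine ContMap.isLUB_of_forall fun x => ?_
    rw [Heckmann.isLUB_iff ((hn.image _).image _)]
    simp only [Set.exists_mem_image, ContMap.ofOpens_ne_bot, ContMap.ofOpens_eq_top]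
    exact ⟨⟨fun _ => ⟨_, hn.some_mem, Or.inl trivial⟩, fun _ => Or.inl trivial⟩, Opens.mem_sSup⟩
  have := (Heckmann.isLUB_iff ((hn.image _).image _)).1 (φ.2 (hn.image _)
    (directedOn_image.2 (hd.mono fun _ _ h => ContMap.ofOpens_mono le_rfl h)) hlub)
  simp only [Set.exists_mem_image] at this
  exact this.2.1 h

theorem Meets.exists_of_sSup {φ : DoublePower X} {S : Set (Opens X)} (hn : S.Nonempty)
    (hd : DirectedOn (· ≤ ·) S) (h : φ.Meets (sSup S)) : ∃ U ∈ S, φ.Meets U := by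
  have hlub : IsLUB ((fun V => ContMap.ofOpens V ⊥) '' S) (ContMap.ofOpens (sSup S) ⊥) := by
    refine ContMap.isLUB_of_forall fun x => ?_
    rw [Heckmann.isLUB_iff ((hn.image _).image _)]
    simp only [Set.exists_mem_image, ContMap.ofOpens_ne_bot, ContMap.ofOpens_eq_top]
    exact ⟨⟨fun h => (h.elim Opens.mem_sSup.1 False.elim).imp fun U hU => ⟨hU.1, Or.inl hU.2⟩,
      fun ⟨U, hU, h⟩ => Or.inl (Opens.mem_sSup.2 ⟨U, hU, h.elim id False.elim⟩)⟩,
      False.elim, fun ⟨_, _, h⟩ => h⟩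
  have := (Heckmann.isLUB_iff ((hn.image _).image _)).1 (φ.2 (hn.image _)
    (directedOn_image.2 (hd.mono fun _ _ h => ContMap.ofOpens_mono h le_rfl)) hlub)
  simp only [Set.exists_mem_image] at this
  exact this.1.1 h

section Hom01

variable {φ : DoublePower X} (hφ : φ ∈ (hom01 X).carrier)
include hφ

/-- Adding the constant `⊥` to `f` lowers the value `⊤` to `m` and keeps the set where `f` is not
`⊥`; since `φ` preserves `⊥`, the first bit of `φ f` is unchanged. -/
theorem meets_neBot (f : ContMap X Heckmann) : φ.Meets f.neBot ↔ φ.1 f ≠ Heckmann.bot := by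
  have : ContMap.ofOpens f.neBot ⊥ = f ⋓ ContMap.const X Heckmann.bot :=
    ContMap.ext_heckmann
      (fun x => ContMap.ofOpens_ne_bot.trans <| (or_congr Iff.rfl ⟨False.elim, fun h => h rfl⟩).trans
        Heckmann.op_ne_bot.symm)
      (fun _ => ContMap.ofOpens_eq_top.trans
        ⟨False.elim, fun h => nomatch (Heckmann.op_eq_top.1 h).2⟩)
  rw [Meets, this, hφ.1, hφ.2.1, Heckmann.op_ne_bot]
  simp

theorem inside_eqTop (f : ContMap X Heckmann) : φ.Inside f.eqTop ↔ φ.1 f = Heckmann.top := by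
  have : ContMap.ofOpens ⊤ f.eqTop = f ⋓ ContMap.const X Heckmann.top :=
    ContMap.ext_heckmann
      (fun _ => ContMap.ofOpens_ne_bot.trans
        ⟨fun _ => Heckmann.op_ne_bot.2 (Or.inr nofun), fun _ => Or.inl trivial⟩)
      (fun _ => ContMap.ofOpens_eq_top.trans <| (and_iff_left rfl).symm.trans
        Heckmann.op_eq_top.symm)
  rw [Inside, this, hφ.1, hφ.2.2, Heckmann.op_eq_top]
  simp

theorem not_meets_bot : ¬ φ.Meets ⊥ := by
  have h := (meets_neBot hφ (ContMap.const X Heckmann.bot)).not.2 (not_not.2 hφ.2.1)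
  exact fun h' => h (h'.mono le_rfl bot_le)

theorem inside_top : φ.Inside ⊤ :=
  ((inside_eqTop hφ (ContMap.const X Heckmann.top)).2 hφ.2.2).mono le_rfl le_top

theorem meets_sup {U V : Opens X} (h : φ.Meets (U ⊔ V)) : φ.Meets U ∨ φ.Meets V := by
  rw [Meets, Meets, ← Heckmann.op_ne_bot, ← hφ.1]
  refine (Heckmann.le_iff_imp.1 (φ.2.monotone fun x => Heckmann.le_iff_imp.2 ⟨?_, ?_⟩)).1 h
  · simp only [ContMap.op_apply, Heckmann.op_ne_bot, ContMap.ofOpens_ne_bot]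
    rintro ((h | h) | h)
    · exact Or.inl (Or.inl h)
    · exact Or.inr (Or.inl h)
    · exact h.elim
  · rw [ContMap.ofOpens_eq_top]
    exact False.elim

theorem inside_inf {U V : Opens X} (hU : φ.Inside U) (hV : φ.Inside V) : φ.Inside (U ⊓ V) := by
  have h := Heckmann.op_eq_top.2 ⟨hU, hV⟩
  rw [← hφ.1] at h
  refine (Heckmann.le_iff_imp.1 (φ.2.monotone fun x => Heckmann.le_iff_imp.2 ⟨?_, ?_⟩)).2 h
  · exact fun _ => ContMap.ofOpens_ne_bot.2 (Or.inl trivial)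
  · simp only [ContMap.op_apply, Heckmann.op_eq_top, ContMap.ofOpens_eq_top]
    exact id

/-- The unmet open sets are closed under binary unions, hence directed, and by continuity their
union is unmet too. -/
theorem not_meets_sSup : ¬ φ.Meets (sSup {U | ¬ φ.Meets U}) := by
  intro h
  obtain ⟨U, hU, hMU⟩ := h.exists_of_sSup ⟨⊥, not_meets_bot hφ⟩ (fun U (hU : ¬ _) V (hV : ¬ _) =>
    ⟨U ⊔ V, fun h => (meets_sup hφ h).elim hU hV, le_sup_left, le_sup_right⟩)
  exact hU hMU

theorem meets_iff (U : Opens X) :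
    φ.Meets U ↔ ∃ x ∈ ((sSup {U | ¬ φ.Meets U} : Opens X) : Set X)ᶜ, x ∈ U := by
  constructor
  · intro h
    by_contra! hU
    exact not_meets_sSup hφ (h.mono le_rfl fun x hx => not_not.1 fun hx' => hU x hx' hx)
  · rintro ⟨x, hx, hxU⟩
    by_contra h
    exact hx (Opens.mem_sSup.2 ⟨U, h, hxU⟩)

theorem inside_iff (hX : IsContinuousDcpo X) (V : Opens X) :
    φ.Inside V ↔ ∀ x, (∀ U, φ.Inside U → x ∈ U) → x ∈ V :=
  ⟨fun h _ hx => hx V h, hX.mem_of_forall_mem_filter φ.Inside (fun _ _ h h' => h'.mono le_rfl h)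
    (fun _ _ => inside_inf hφ) (inside_top hφ) (fun _ hn hd h => h.exists_of_sSup hn hd)⟩

theorem exists_represents (hX : IsContinuousDcpo X) : ∃ L : FormalLens X, L.Represents φ := by
  refine ⟨⟨((sSup {U | ¬ φ.Meets U} : Opens X) : Set X)ᶜ, {x | ∀ U, φ.Inside U → x ∈ U},
    (Opens.isOpen _).isClosed_compl, ?_, ?_, ?_⟩, fun f => ⟨?_, ?_⟩⟩
  · refine isCompact_of_finite_subcover fun {ι} U hU h => ?_
    classical
    -- The cover is rewritten as a directed union of finite subunions, so that Scott-openness of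
    -- `Inside` selects one of these.
    have hTU : φ.Inside
        (sSup (Set.range fun t : Finset ι => t.sup fun i => (⟨U i, hU i⟩ : Opens X))) := by
      refine (inside_iff hφ hX _).2 fun x hx => ?_
      obtain ⟨i, hi⟩ := Set.mem_iUnion.1 (h hx)
      exact Opens.mem_sSup.2 ⟨_, ⟨{i}, rfl⟩, by simpa using hi⟩
    obtain ⟨_, ⟨t, rfl⟩, ht⟩ := hTU.exists_of_sSup (Set.range_nonempty _) (by
      rintro _ ⟨s, rfl⟩ _ ⟨t, rfl⟩
      exact ⟨_, ⟨s ∪ t, rfl⟩, Finset.sup_mono Finset.subset_union_left,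
        Finset.sup_mono Finset.subset_union_right⟩)
    refine ⟨t, fun x hx => ?_⟩
    have : x ∈ ((t.sup fun i => (⟨U i, hU i⟩ : Opens X) : Opens X) : Set X) := hx _ ht
    simpa [Opens.coe_finset_sup] using this
  · exact fun x y hxy hx U hU => isUpperSet_of_isScottOpen U.isOpen hxy (hx U hU)
  -- If `C` and `Q` were disjoint, `Q` would lie in the largest unmet open set `U`. The map that is
  -- `⊤` on `U` and `⊥` elsewhere would be sent to `⊤`, so `φ` would meet `U`.
  · by_contra h
    have hT : φ.Inside (sSup {U | ¬ φ.Meets U}) := (inside_iff hφ hX _).2 fun x hx => by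
      by_contra hx'
      exact h ⟨x, hx', hx⟩
    refine not_meets_sSup hφ ?_
    set U := sSup {U | ¬ φ.Meets U}
    have h₁ : φ.1 (ContMap.ofOpens U U) = Heckmann.top :=
      (inside_eqTop hφ _).1 (hT.mono le_rfl fun _ hx => ContMap.ofOpens_eq_top.2 hx)
    have h₂ := (meets_neBot hφ _).2 (show φ.1 (ContMap.ofOpens U U) ≠ Heckmann.bot by simp [h₁])
    exact h₂.mono le_rfl fun _ hx => or_self_iff.1 (ContMap.ofOpens_ne_bot.1 hx)
  · rw [← meets_neBot hφ]
    exact meets_iff hφ _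
  · rw [← inside_eqTop hφ]
    exact inside_iff hφ hX _

end Hom01

end DoublePower

/-- Homomorphisms preserving bottom and top correspond to formal lenses. -/
theorem exists_orderIso_formalLens (hX : IsContinuousDcpo X) :
    ∃ i : (hom01 X).carrier ≃o FormalLens X,
      (∀ φ, (i φ).Represents φ.1) ∧ ∀ φ ψ, i (φ ⋓ ψ) = (i φ).union (i ψ) := by
  choose i hi using fun φ : (hom01 X).carrier => DoublePower.exists_represents φ.2 hX
  refine ⟨{ toFun := i
            invFun := fun L => ⟨L.toDoublePower, L.represents_toDoublePower.mem_hom01⟩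
            left_inv := fun φ => ?_
            right_inv := fun L => (hi _).unique L.represents_toDoublePower
            map_rel_iff' := fun {φ ψ} => ((hi φ).le_iff (hi ψ)).symm }, hi, fun φ ψ =>
    (hi (φ ⋓ ψ)).unique ((hi φ).op (hi ψ))⟩
  refine Subtype.ext (le_antisymm ?_ ?_)
  · exact ((i φ).represents_toDoublePower.le_iff (hi φ)).2 le_rfl
  · exact ((hi φ).le_iff (i φ).represents_toDoublePower).2 le_rfl

end Lens

/-! ### Homomorphisms and equable maps -/

section Equable

variable {A B : Type u} {C : Type v} {Y : Type u} [PartialOrder A] [PartialOrder B]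
  [PartialOrder C] [PartialOrder Y] [DcpoAlgebra A] [DcpoAlgebra B] [DcpoAlgebra C]

theorem DcpoAlgebra.op_mono {a b c d : C} (h : a ≤ c) (h' : b ≤ d) : a ⋓ b ≤ c ⋓ d :=
  (DcpoAlgebra.op_continuous (A := C)).monotone (show (a, b) ≤ (c, d) from ⟨h, h'⟩)

/-- Composition of homomorphisms. -/
def Hom.comp (g : Hom B C) (f : Hom A B) : Hom A C :=
  ⟨fun a => g.1 (f.1 a), scottContinuous_comp g.2.1 f.2.1, fun a b => by simp only [f.2.2, g.2.2]⟩

theorem Hom.isEquable_iff {e : Hom A B} :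
    e.IsEquable C ↔
      (∀ h k : Hom B C, (∀ a, h.1 (e.1 a) ≤ k.1 (e.1 a)) → h ≤ k) ∧
        ∀ u : Hom A C, ∃ h : Hom B C, ∀ a, h.1 (e.1 a) = u.1 a := by
  constructor
  · rintro ⟨i, hi⟩
    refine ⟨fun h k hhk => i.le_iff_le.1 fun a => ?_, fun u => ⟨i.symm u, fun a => ?_⟩⟩
    · rw [hi, hi]
      exact hhk a
    · rw [← hi, i.apply_symm_apply]
  · rintro ⟨hle, hex⟩
    choose g hg using hex
    exact ⟨{ toFun := fun h => h.comp e
             invFun := g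
             left_inv := fun h => le_antisymm (hle _ _ fun a => (hg _ a).le)
               (hle _ _ fun a => (hg (h.comp e) a).ge)
             right_inv := fun u => Subtype.ext (funext (hg u))
             map_rel_iff' := ⟨fun h => hle _ _ h, fun h a => h (e.1 a)⟩ }, fun _ _ => rfl⟩

theorem ContMap.isEquable_iff {e : ContMap Y B} :
    e.IsEquable C ↔
      (∀ h k : Hom B C, (∀ y, h.1 (e.1 y) ≤ k.1 (e.1 y)) → h ≤ k) ∧
        ∀ u : ContMap Y C, ∃ h : Hom B C, ∀ y, h.1 (e.1 y) = u.1 y := by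
  constructor
  · rintro ⟨i, hi⟩
    refine ⟨fun h k hhk => i.le_iff_le.1 fun a => ?_, fun u => ⟨i.symm u, fun a => ?_⟩⟩
    · rw [hi, hi]
      exact hhk a
    · rw [← hi, i.apply_symm_apply]
  · rintro ⟨hle, hex⟩
    choose g hg using hex
    exact ⟨{ toFun := fun h => ⟨fun a => h.1 (e.1 a), scottContinuous_comp h.2.1 e.2⟩
             invFun := g
             left_inv := fun h => le_antisymm (hle _ _ fun a => (hg _ a).le)
               (hle _ _ fun a => (hg ⟨_, scottContinuous_comp h.2.1 e.2⟩ a).ge)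
             right_inv := fun u => Subtype.ext (funext (hg u))
             map_rel_iff' := ⟨fun h => hle _ _ h, fun h a => h (e.1 a)⟩ }, fun _ _ => rfl⟩

/-- A directed family of homomorphisms has a pointwise supremum. -/
theorem Hom.exists_pointwise_sup {d : Set (Hom B C)} (hn : d.Nonempty)
    (hd : DirectedOn (· ≤ ·) d) :
    ∃ k : Hom B C, ∀ b, IsLUB ((fun h : Hom B C => h.1 b) '' d) (k.1 b) := by
  set d' : Set (ContMap B C) := (fun h : Hom B C => ⟨h.1, h.2.1⟩) '' d with hd'
  have hn' : d'.Nonempty := hn.image _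
  have hdir' : DirectedOn (· ≤ ·) d' := directedOn_image.2 (hd.mono fun _ _ h => h)
  obtain ⟨s, hs⟩ := ContMap.exists_pointwise_sup hn' hdir'
  refine ⟨⟨s.1, s.2, fun a b => ?_⟩, fun b => ?_⟩
  · have h₁ := scottContinuous_op (ContMap.scottContinuous_apply a)
      (ContMap.scottContinuous_apply b) hn' hdir' (ContMap.isLUB_of_forall hs)
    refine (hs (a ⋓ b)).unique ?_
    convert h₁ using 1
    refine Set.image_congr ?_
    rintro _ ⟨h, _, rfl⟩
    exact h.2.2 a b
  · have := hs b
    rwa [hd', Set.image_image] at this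

/-- The homomorphism `φ ↦ φ f` on a subalgebra of the double power. -/
def SubAlgebra.evalHom {X : Type u} [PartialOrder X] (S : SubAlgebra (DoublePower X))
    (f : ContMap X Heckmann) : Hom S.carrier Heckmann :=
  ⟨fun φ => φ.1.1 f, scottContinuous_comp (ContMap.scottContinuous_apply f) S.scottContinuous_val,
    fun _ _ => rfl⟩

/-- Pointwise extension of maps into `hom_{0,1}(A ^ X, A)`. -/
theorem exists_hom_hom01 {X : Type u} [PartialOrder X] {Z : Type w} (e : Z → B)
    (hle : ∀ h k : Hom B Heckmann, (∀ z, h.1 (e z) ≤ k.1 (e z)) → h ≤ k)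
    (u : Z → (hom01 X).carrier)
    (hex : ∀ f : ContMap X Heckmann, ∃ h : Hom B Heckmann, ∀ z, h.1 (e z) = (u z).1.1 f) :
    ∃ h : Hom B (hom01 X).carrier, ∀ z, h.1 (e z) = u z := by
  have heq : ∀ h k : Hom B Heckmann, (∀ z, h.1 (e z) = k.1 (e z)) → h = k := fun h k H =>
    le_antisymm (hle _ _ fun z => (H z).le) (hle _ _ fun z => (H z).ge)
  -- `g f` is the unique extension of the coordinate of `u` at `f`. Every property of `u z` as a
  -- function of `f` passes to `g` because two homomorphisms agreeing along `e` are equal.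
  choose g hg using hex
  have hmono : Monotone g := fun f f' hff => hle _ _ fun z => by
    rw [hg, hg]
    exact (u z).1.2.monotone hff
  have hcont : ∀ b, ScottContinuous fun f => (g f).1 b := by
    intro b d hn hd f hf
    obtain ⟨k, hk⟩ := Hom.exists_pointwise_sup (hn.image g)
      (directedOn_image.2 (hd.mono fun _ _ h => hmono h))
    have hkg : k = g f := heq _ _ fun z => by
      rw [hg]
      refine (hk (e z)).unique ?_
      rw [Set.image_image]
      simp only [hg]
      exact (u z).1.2 hn hd hf
    have := hk b
    rwa [Set.image_image, hkg] at this
  have hmem : ∀ b, (⟨fun f => (g f).1 b, hcont b⟩ : DoublePower X) ∈ (hom01 X).carrier := by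
    intro b
    refine ⟨fun f f' => ?_, ?_, ?_⟩
    -- The pointwise union of two homomorphisms is again one, since the operation of `A` satisfies
    -- the interchange law `op_op_op_comm`.
    · let k : Hom B Heckmann := ⟨fun b => (g f).1 b ⋓ (g f').1 b,
        scottContinuous_op (g f).2.1 (g f').2.1, fun a b => by
          simp only [(g f).2.2, (g f').2.2, Heckmann.op_op_op_comm]⟩
      have : g (f ⋓ f') = k := heq _ _ fun z => by
        change _ = (g f).1 (e z) ⋓ (g f').1 (e z)
        rw [hg, hg, hg, (u z).2.1]
      exact congrArg (fun h : Hom B Heckmann => h.1 b) this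
    · let k : Hom B Heckmann := ⟨fun _ => Heckmann.bot, ScottContinuous.const _, fun _ _ => rfl⟩
      have : g (ContMap.const X Heckmann.bot) = k := heq _ _ fun z => by
        rw [hg]
        exact (u z).2.2.1
      exact congrArg (fun h : Hom B Heckmann => h.1 b) this
    · let k : Hom B Heckmann := ⟨fun _ => Heckmann.top, ScottContinuous.const _, fun _ _ => rfl⟩
      have : g (ContMap.const X Heckmann.top) = k := heq _ _ fun z => by
        rw [hg]
        exact (u z).2.2.2
      exact congrArg (fun h : Hom B Heckmann => h.1 b) this
  refine ⟨⟨fun b => ⟨⟨fun f => (g f).1 b, hcont b⟩, hmem b⟩, ?_, fun a b => ?_⟩, fun z => ?_⟩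
  · exact (hom01 X).scottContinuous_of_val (ContMap.scottContinuous_of_apply fun f => (g f).2.1)
  · exact Subtype.ext (Subtype.ext (funext fun f => (g f).2.2 a b))
  · exact Subtype.ext (Subtype.ext (funext fun f => hg f z))

theorem hom_hom01_le {X : Type u} [PartialOrder X] {Z : Type w} (e : Z → B)
    (hle : ∀ h k : Hom B Heckmann, (∀ z, h.1 (e z) ≤ k.1 (e z)) → h ≤ k)
    (h k : Hom B (hom01 X).carrier) (hhk : ∀ z, h.1 (e z) ≤ k.1 (e z)) : h ≤ k :=
  fun b f => hle (((hom01 X).evalHom f).comp h) (((hom01 X).evalHom f).comp k)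
    (fun z => hhk z f) b

theorem isCompleteAlgebra_hom01 (X : Type u) [PartialOrder X] :
    IsCompleteAlgebra Heckmann (hom01 X).carrier := by
  intro A B _ _ _ _ e he
  rw [Hom.isEquable_iff] at he ⊢
  exact ⟨hom_hom01_le e.1 he.1, fun u => exists_hom_hom01 e.1 he.1 u.1 fun f =>
    he.2 (((hom01 X).evalHom f).comp u)⟩

theorem isWeaklyCompleteAlgebra_hom01 (X : Type u) [PartialOrder X] :
    IsWeaklyCompleteAlgebra Heckmann (hom01 X).carrier := by
  intro Y B _ _ _ _ e he
  rw [ContMap.isEquable_iff] at he ⊢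
  exact ⟨hom_hom01_le e.1 he.1, fun u => exists_hom_hom01 e.1 he.1 u.1 fun f =>
    he.2 ⟨fun y => (u.1 y).1.1 f, scottContinuous_comp ((hom01 X).evalHom f).2.1 u.2⟩⟩

/-- Homomorphisms on a generated subalgebra are compared on the generators. -/
theorem SubAlgebra.hom_le_of_generated {E : Type u} [PartialOrder E] [DcpoAlgebra E] {s : Set E}
    (h k : Hom (generated s).carrier C)
    (hhk : ∀ a (ha : a ∈ (generated s).carrier), a ∈ s → h.1 ⟨a, ha⟩ ≤ k.1 ⟨a, ha⟩) : h ≤ k := by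
  -- The elements at which the inequality holds form a subalgebra containing the generators.
  let S : SubAlgebra E :=
    { carrier := {a | ∃ ha : a ∈ (generated s).carrier, h.1 ⟨a, ha⟩ ≤ k.1 ⟨a, ha⟩}
      op_mem := fun a ⟨ha, ha'⟩ b ⟨hb, hb'⟩ => ⟨(generated s).op_mem a ha b hb, by
        have h₁ := h.2.2 ⟨a, ha⟩ ⟨b, hb⟩
        have h₂ := k.2.2 ⟨a, ha⟩ ⟨b, hb⟩
        exact h₁.le.trans ((DcpoAlgebra.op_mono ha' hb').trans h₂.ge)⟩
      sup_mem := fun d hds hn hd a ha => by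
        have hdg : d ⊆ (generated s).carrier := fun b hb => (hds hb).1
        have hag := (generated s).sup_mem d hdg hn hd a ha
        refine ⟨hag, ?_⟩
        have hl : IsLUB {b : (generated s).carrier | b.1 ∈ d} ⟨a, hag⟩ :=
          ⟨fun b hb => ha.1 hb, fun c hc => ha.2 fun b hb => hc (a := ⟨b, hdg hb⟩) hb⟩
        refine (h.2.1 (hn.elim fun b hb => ⟨⟨b, hdg hb⟩, hb⟩) (fun b hb c hc => ?_) hl).2 ?_
        · obtain ⟨z, hz, h₁, h₂⟩ := hd b.1 hb c.1 hc
          exact ⟨⟨z, hdg hz⟩, hz, h₁, h₂⟩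
        · rintro _ ⟨b, hb, rfl⟩
          exact (hds hb).2.trans (k.2.1.monotone (hl.1 hb)) }
  intro a
  exact (a.2 S fun b hb => ⟨fun T hT => hT hb, hhk b _ hb⟩).2

end Equable

/-! ### Density of the evaluations -/

namespace FormalLens

variable {X : Type u} [PartialOrder X]

/-- The formal lens `(↓y ∪ ↓F, Q)` for a finite set `F` and a point `y` of `Q`. -/
def lowerApprox (L : FormalLens X) (y : X) (hy : y ∈ L.Q) (F : Finset X) : FormalLens X where
  C := Set.Iic y ∪ ⋃ x ∈ F, Set.Iic x
  Q := L.Q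
  isClosed := (isScottClosed_Iic y).union
    (F.finite_toSet.isClosed_biUnion fun x _ => isScottClosed_Iic x)
  isCompact := L.isCompact
  saturated := L.saturated
  nonempty := ⟨y, Or.inl le_rfl, hy⟩

/-- The formal lens `(C, ↑y ∪ ↑F)` for a finite set `F` and a point `y` of `C`. -/
def upperApprox (L : FormalLens X) (y : X) (hy : y ∈ L.C) (F : Finset X) : FormalLens X where
  C := L.C
  Q := Set.Ici y ∪ ⋃ x ∈ F, Set.Ici x
  isClosed := L.isClosed
  isCompact := (point y).isCompact.union
    (F.finite_toSet.isCompact_biUnion fun x _ => (point x).isCompact)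
  saturated := (isUpperSet_Ici y).union (isUpperSet_iUnion₂ fun x _ => isUpperSet_Ici x)
  nonempty := ⟨y, hy, Or.inl le_rfl⟩

theorem isLUB_lowerApprox (L : FormalLens X) (y : X) (hyC : y ∈ L.C) (hyQ : y ∈ L.Q) :
    IsLUB (L.lowerApprox y hyQ '' {F | ∀ x ∈ F, x ∈ L.C}) L := by
  have hlow := isLowerSet_of_isScottClosed L.isClosed
  constructor
  · rintro _ ⟨F, hF, rfl⟩
    refine le_iff.2 ⟨Set.union_subset (hlow.Iic_subset hyC) ?_, Set.Subset.rfl⟩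
    exact Set.iUnion₂_subset fun x hx => hlow.Iic_subset (hF x hx)
  · intro L' hL'
    refine le_iff.2 ⟨fun x hx => ?_, (le_iff.1 (hL' ⟨∅, by simp, rfl⟩)).2⟩
    refine (le_iff.1 (hL' ⟨{x}, by simpa using hx, rfl⟩)).1 (Or.inr ?_)
    simp

theorem directedOn_lowerApprox (L : FormalLens X) (y : X) (hyQ : y ∈ L.Q) :
    DirectedOn (· ≤ ·) (L.lowerApprox y hyQ '' {F | ∀ x ∈ F, x ∈ L.C}) := by
  classical
  rintro _ ⟨F, hF, rfl⟩ _ ⟨G, hG, rfl⟩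
  refine ⟨_, ⟨F ∪ G, fun x hx => (Finset.mem_union.1 hx).elim (hF x) (hG x), rfl⟩, ?_, ?_⟩
  · exact le_iff.2 ⟨Set.union_subset_union_right _ (Set.biUnion_subset_biUnion_left
      (Finset.coe_subset.2 Finset.subset_union_left)), Set.Subset.rfl⟩
  · exact le_iff.2 ⟨Set.union_subset_union_right _ (Set.biUnion_subset_biUnion_left
      (Finset.coe_subset.2 Finset.subset_union_right)), Set.Subset.rfl⟩

section

variable {H : FormalLens X → Heckmann} (hH : ScottContinuous H)
  (hop : ∀ L L', H (L.union L') = H L ⋓ H L')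
include hH hop

theorem eq_bot_lowerApprox (L : FormalLens X) (y : X) (hy : y ∈ L.Q)
    (hbot : H (point y) = Heckmann.bot) (F : Finset X)
    (hF : ∀ x ∈ F, H (point x) = Heckmann.bot) : H (L.lowerApprox y hy F) = Heckmann.bot := by
  classical
  induction F using Finset.induction_on with
  | empty =>
    refine Heckmann.eq_bot_of_le_bot (hbot ▸ hH.monotone (le_iff.2 ⟨?_, ?_⟩))
    · simp [lowerApprox, point]
    · exact L.saturated.Ici_subset hy
  | insert x F _ ih =>
    have ih := ih fun z hz => hF z (Finset.mem_insert_of_mem hz)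
    -- The first component of `point x` absorbs the inserted point. Both unions therefore have the
    -- same image, and a union with value `⊥` has both parts equal to `⊥`.
    have : (L.lowerApprox y hy (insert x F)).union (point x) =
        (L.lowerApprox y hy F).union (point x) := by
      refine FormalLens.ext ?_ rfl
      simp only [union, lowerApprox, point, Finset.set_biUnion_insert]
      grind
    have h := hop (L.lowerApprox y hy F) (point x)
    rw [← this, hop, ih, hF x (Finset.mem_insert_self x F)] at h
    exact (Heckmann.op_eq_bot.1 (h.trans (Heckmann.op_eq_bot.2 ⟨rfl, rfl⟩))).1

theorem eq_top_upperApprox (L : FormalLens X) (y : X) (hy : y ∈ L.C)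
    (htop : H (point y) = Heckmann.top) (F : Finset X)
    (hF : ∀ x ∈ F, H (point x) = Heckmann.top) : H (L.upperApprox y hy F) = Heckmann.top := by
  classical
  induction F using Finset.induction_on with
  | empty =>
    refine Heckmann.eq_top_of_top_le (htop ▸ hH.monotone (le_iff.2 ⟨?_, ?_⟩))
    · exact (isLowerSet_of_isScottClosed L.isClosed).Iic_subset hy
    · simp [upperApprox, point]
  | insert x F _ ih =>
    have ih := ih fun z hz => hF z (Finset.mem_insert_of_mem hz)
    -- The dual absorption, in the second component; a union with value `⊤` has both parts equal to
    -- `⊤`.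
    have : (L.upperApprox y hy (insert x F)).union (point x) =
        (L.upperApprox y hy F).union (point x) := by
      refine FormalLens.ext rfl ?_
      simp only [union, upperApprox, point, Finset.set_biUnion_insert]
      grind
    have h := hop (L.upperApprox y hy F) (point x)
    rw [← this, hop, ih, hF x (Finset.mem_insert_self x F)] at h
    exact (Heckmann.op_eq_top.1 (h.trans (Heckmann.op_eq_top.2 ⟨rfl, rfl⟩))).1

/-- `L` is the directed supremum of its lower approximations, and these are sent to `⊥` if all
points of `C` are. Conversely, uniting `L` with a point of `C` only enlarges `Q`, which moves down
in the order. -/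
theorem hom_ne_bot_iff (L : FormalLens X) :
    H L ≠ Heckmann.bot ↔ ∃ x ∈ L.C, H (point x) ≠ Heckmann.bot := by
  constructor
  · intro h
    by_contra! hC
    obtain ⟨y, hyC, hyQ⟩ := L.nonempty
    have hn : (L.lowerApprox y hyQ '' {F | ∀ x ∈ F, x ∈ L.C}).Nonempty := ⟨_, ∅, by simp, rfl⟩
    obtain ⟨_, ⟨_, ⟨F, hF, rfl⟩, rfl⟩, h'⟩ := ((Heckmann.isLUB_iff (hn.image H)).1
      (hH hn (L.directedOn_lowerApprox y hyQ) (L.isLUB_lowerApprox y hyC hyQ))).1.1 h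
    exact h' (eq_bot_lowerApprox hH hop L y hyQ (hC y hyC) F fun x hx => hC x (hF x hx))
  · rintro ⟨x, hx, h⟩
    have hle : L.union (point x) ≤ L := le_iff.2
      ⟨Set.union_subset Set.Subset.rfl
        ((isLowerSet_of_isScottClosed L.isClosed).Iic_subset hx), Set.subset_union_left⟩
    refine (Heckmann.le_iff_imp.1 (hH.monotone hle)).1 ?_
    rw [hop]
    exact Heckmann.op_ne_bot.2 (Or.inr h)

theorem hom_eq_top_iff (hX : IsContinuousDcpo X)
    (hpt : ScottContinuous fun x => H (point x)) (L : FormalLens X) :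
    H L = Heckmann.top ↔ ∀ x ∈ L.Q, H (point x) = Heckmann.top := by
  constructor
  · intro h x hx
    have hle : L ≤ L.union (point x) := le_iff.2
      ⟨Set.subset_union_left, Set.union_subset Set.Subset.rfl (L.saturated.Ici_subset hx)⟩
    have := (Heckmann.le_iff_imp.1 (hH.monotone hle)).2 h
    rw [hop] at this
    exact (Heckmann.op_eq_top.1 this).2
  · intro h
    obtain ⟨F, hF, hFQ⟩ := hX.exists_finset_of_isCompact L.isCompact
      (scottContinuous_heckmann_iff.1 hpt).2 h
    obtain ⟨x, hxC, hxQ⟩ := L.nonempty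
    -- Choosing `y` in `F` below a point of `C ∩ Q` puts it in the lower set `C`, so the upper
    -- approximation is a lens; it lies below `L` because `Q` is contained in the upper set of `F`.
    obtain ⟨y, hyF, hyx⟩ := hFQ x hxQ
    have hyC := isLowerSet_of_isScottClosed L.isClosed hyx.le hxC
    have hle : L.upperApprox y hyC F ≤ L := le_iff.2 ⟨Set.Subset.rfl, fun z hz => by
      obtain ⟨w, hw, hwz⟩ := hFQ z hz
      exact Or.inr (Set.mem_iUnion₂.2 ⟨w, hw, hwz.le⟩)⟩
    exact (Heckmann.le_iff_imp.1 (hH.monotone hle)).2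
      (eq_top_upperApprox hH hop L y hyC (hF y hyF) F hF)

end

end FormalLens

/-! ### Equability of the evaluations and leastness of `hom01` -/

section Repletion

variable {X : Type u} [PartialOrder X]

/-- The point evaluations as a map into `hom_{0,1}(A ^ X, A)`. -/
def evalHom01 (X : Type u) [PartialOrder X] : ContMap X (hom01 X).carrier :=
  (hom01 X).corestrict (eval X Heckmann) eval_mem_hom01

/-- A homomorphism from `hom_{0,1}(A ^ X, A)` to `A` is evaluation at its restriction to `X`. -/
theorem hom_hom01_apply (hX : IsContinuousDcpo X) (h : Hom (hom01 X).carrier Heckmann)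
    (φ : (hom01 X).carrier) :
    h.1 φ = φ.1.1 ⟨fun x => h.1 ((evalHom01 X).1 x),
      scottContinuous_comp h.2.1 (evalHom01 X).2⟩ := by
  obtain ⟨i, hi, hiop⟩ := exists_orderIso_formalLens hX
  have hpt (x : X) : i.symm (FormalLens.point x) = (evalHom01 X).1 x := by
    rw [OrderIso.symm_apply_eq]
    exact (FormalLens.represents_point x).unique (hi _)
  have hH : ScottContinuous fun L => h.1 (i.symm L) :=
    scottContinuous_comp h.2.1 fun d _ _ a ha => i.symm.isLUB_image'.2 ha
  have hop (L L' : FormalLens X) : h.1 (i.symm (L.union L')) =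
      h.1 (i.symm L) ⋓ h.1 (i.symm L') := by
    rw [← h.2.2]
    refine congrArg h.1 ?_
    rw [OrderIso.symm_apply_eq, hiop, i.apply_symm_apply, i.apply_symm_apply]
  have hb := FormalLens.hom_ne_bot_iff hH hop (i φ)
  have ht := FormalLens.hom_eq_top_iff hH hop hX (by
    simp only [hpt]
    exact scottContinuous_comp h.2.1 (evalHom01 X).2) (i φ)
  simp only [hpt, i.symm_apply_apply] at hb ht
  have hφ := hi φ ⟨_, scottContinuous_comp h.2.1 (evalHom01 X).2⟩
  exact Heckmann.eq_iff.2 ⟨hb.trans hφ.1.symm, ht.trans hφ.2.symm⟩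

theorem isEquable_evalHom01 (hX : IsContinuousDcpo X) : (evalHom01 X).IsEquable Heckmann := by
  refine ContMap.isEquable_iff.2 ⟨fun h k hhk φ => ?_, fun u => ⟨(hom01 X).evalHom u, fun _ => rfl⟩⟩
  rw [hom_hom01_apply hX h, hom_hom01_apply hX k]
  exact φ.1.2.monotone hhk

/-- The inclusion of one subalgebra in another. -/
def SubAlgebra.inclusion {E : Type u} [PartialOrder E] [DcpoAlgebra E] {S T : SubAlgebra E}
    (h : S ≤ T) : Hom S.carrier T.carrier :=
  ⟨fun a => ⟨a.1, h a.2⟩, T.scottContinuous_of_val S.scottContinuous_val, fun _ _ => rfl⟩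

/-- Completeness speaks of homomorphisms only, so the free-standing map `evalHom01` is replaced by
this inclusion: a homomorphism on `evalSub X` is restricted to the points, extended to `hom01 X`,
and recovered because the points generate. -/
theorem isEquable_inclusion_evalSub (hX : IsContinuousDcpo X) :
    (SubAlgebra.inclusion (evalSub_le_hom01 X)).IsEquable Heckmann := by
  have he := ContMap.isEquable_iff.1 (isEquable_evalHom01 hX)
  refine Hom.isEquable_iff.2 ⟨fun h k hhk => he.1 h k fun x => hhk ((evalSubMap X).1 x),
    fun u => ?_⟩
  obtain ⟨h, hh⟩ := he.2 ⟨fun x => u.1 ((evalSubMap X).1 x),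
    scottContinuous_comp u.2.1 (evalSubMap X).2⟩
  refine ⟨h, fun a => le_antisymm ?_ ?_⟩
  · refine SubAlgebra.hom_le_of_generated
      (h.comp (SubAlgebra.inclusion (evalSub_le_hom01 X))) u ?_ a
    rintro _ ha ⟨x, rfl⟩
    exact (hh x).le
  · refine SubAlgebra.hom_le_of_generated u
      (h.comp (SubAlgebra.inclusion (evalSub_le_hom01 X))) ?_ a
    rintro _ ha ⟨x, rfl⟩
    exact (hh x).ge

/-- In each coordinate `f`, `h` and the identity give `A`-valued homomorphisms agreeing at the
points, so `h` fixes every element and its values lie in `S`. -/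
theorem hom01_le_of_hom (hX : IsContinuousDcpo X) (S : SubAlgebra (DoublePower X))
    (h : Hom (hom01 X).carrier S.carrier)
    (hh : ∀ x, (h.1 ((evalHom01 X).1 x)).1 = (eval X Heckmann).1 x) : hom01 X ≤ S := by
  intro φ hφ
  have he := ContMap.isEquable_iff.1 (isEquable_evalHom01 hX)
  have : φ = (h.1 ⟨φ, hφ⟩).1 := by
    refine Subtype.ext (funext fun f => le_antisymm ?_ ?_)
    · refine he.1 ((hom01 X).evalHom f) ((S.evalHom f).comp h) (fun x => ?_) ⟨φ, hφ⟩
      exact (congrArg (fun ψ : DoublePower X => ψ.1 f) (hh x)).ge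
    · refine he.1 ((S.evalHom f).comp h) ((hom01 X).evalHom f) (fun x => ?_) ⟨φ, hφ⟩
      exact (congrArg (fun ψ : DoublePower X => ψ.1 f) (hh x)).le
  rw [this]
  exact (h.1 ⟨φ, hφ⟩).2

theorem isLeast_complete_hom01 (hX : IsContinuousDcpo X) :
    IsLeast {S : SubAlgebra (DoublePower X) |
      IsCompleteAlgebra Heckmann S.carrier ∧ ∀ x, (eval X Heckmann).1 x ∈ S.carrier} (hom01 X) := by
  refine ⟨⟨isCompleteAlgebra_hom01 X, eval_mem_hom01⟩, fun S hS => ?_⟩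
  have hle : evalSub X ≤ S := fun a ha => ha S (by rintro _ ⟨x, rfl⟩; exact hS.2 x)
  obtain ⟨h, hh⟩ := (Hom.isEquable_iff.1 (hS.1 _ _ _ (isEquable_inclusion_evalSub hX))).2
    (SubAlgebra.inclusion hle)
  exact hom01_le_of_hom hX S h fun x => congrArg Subtype.val (hh ((evalSubMap X).1 x))

theorem isLeast_weaklyComplete_hom01 (hX : IsContinuousDcpo X) :
    IsLeast {S : SubAlgebra (DoublePower X) |
      IsWeaklyCompleteAlgebra Heckmann S.carrier ∧ ∀ x, (eval X Heckmann).1 x ∈ S.carrier}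
      (hom01 X) := by
  refine ⟨⟨isWeaklyCompleteAlgebra_hom01 X, eval_mem_hom01⟩, fun S hS => ?_⟩
  have := hX.1
  obtain ⟨h, hh⟩ := (ContMap.isEquable_iff.1 (hS.1 _ _ _ (isEquable_evalHom01 hX))).2
    (S.corestrict (eval X Heckmann) hS.2)
  exact hom01_le_of_hom hX S h fun x => congrArg Subtype.val (hh x)

end Repletion

/-! ### Finite joins in a semilattice -/

section Join

variable {B : Type v} [PartialOrder B] [DcpoAlgebra B] (hB : IsSemilattice B)
  {Z : Type u} {Z' : Type w}

/-- The operation of a dcpo-semilattice as a supremum, for an order on `B` that is unrelated to the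
given one. -/
abbrev IsSemilattice.semilatticeSup : SemilatticeSup B :=
  @SemilatticeSup.mk' B ⟨fun a b => a ⋓ b⟩ hB.comm (fun a b c => (hB.assoc a b c).symm) hB.idem

/-- The join `f x₁ ⋓ ⋯ ⋓ f xₙ` over a nonempty finite set. -/
def IsSemilattice.join (f : Z → B) (F : Finset Z) (hF : F.Nonempty) : B :=
  @Finset.sup' B Z hB.semilatticeSup F hF f

theorem IsSemilattice.join_union [DecidableEq Z] (f : Z → B) {F G : Finset Z} (hF : F.Nonempty)
    (hG : G.Nonempty) (hFG : (F ∪ G).Nonempty) :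
    hB.join f (F ∪ G) hFG = hB.join f F hF ⋓ hB.join f G hG :=
  @Finset.sup'_union B Z hB.semilatticeSup _ F G hF hG f

theorem IsSemilattice.join_cons (f : Z → B) {F : Finset Z} (hF : F.Nonempty) {z : Z} (hz : z ∉ F) :
    hB.join f (F.cons z hz) (Finset.cons_nonempty hz) = f z ⋓ hB.join f F hF :=
  @Finset.sup'_cons B Z hB.semilatticeSup F hF f z hz

theorem IsSemilattice.join_image [DecidableEq Z] (f : Z → B) (g : Z' → Z) {F : Finset Z'}
    (hF : F.Nonempty) {G : Finset Z} (hG : G.Nonempty) (h : F.image g = G) :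
    hB.join f G hG = hB.join (fun z => f (g z)) F hF := by
  subst h
  exact @Finset.sup'_image B Z Z' hB.semilatticeSup _ F g hG f

theorem IsSemilattice.join_mono {f g : Z → B} {F : Finset Z} (hF : F.Nonempty)
    (h : ∀ z ∈ F, f z ≤ g z) : hB.join f F hF ≤ hB.join g F hF := by
  induction hF using Finset.Nonempty.cons_induction with
  | singleton z => exact h z (Finset.mem_singleton_self z)
  | cons z F hz hF ih =>
    rw [hB.join_cons f hF, hB.join_cons g hF]
    exact DcpoAlgebra.op_mono (h z (Finset.mem_cons_self z F))
      (ih fun x hx => h x (Finset.mem_cons_of_mem hx))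

theorem IsSemilattice.join_le {f : Z → B} {F : Finset Z} (hF : F.Nonempty) {b : B}
    (h : ∀ z ∈ F, f z ≤ b) : hB.join f F hF ≤ b := by
  refine (hB.join_mono (g := fun _ => b) hF h).trans (le_of_eq ?_)
  exact @Finset.sup'_const B Z hB.semilatticeSup F hF b

/-- Finite joins are monotone for the Egli–Milner order on finite sets. -/
theorem IsSemilattice.join_le_join [PartialOrder Z] {f : Z → B} (hf : Monotone f) {F G : Finset Z}
    (hF : F.Nonempty) (hG : G.Nonempty) (h : ∀ x ∈ F, ∃ y ∈ G, x ≤ y)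
    (h' : ∀ y ∈ G, ∃ x ∈ F, x ≤ y) : hB.join f F hF ≤ hB.join f G hG := by
  classical
  -- The comparable pairs project onto both `F` and `G`; idempotence turns the two joins into joins
  -- over the same set of pairs, where they compare termwise.
  have h₁ : ((F ×ˢ G).filter fun p => p.1 ≤ p.2).image Prod.fst = F := by
    ext x
    simp only [Finset.mem_image, Finset.mem_filter, Finset.mem_product]
    refine ⟨fun ⟨p, hp, hpx⟩ => hpx ▸ hp.1.1, fun hx => ?_⟩
    obtain ⟨y, hy, hxy⟩ := h x hx
    exact ⟨(x, y), ⟨⟨hx, hy⟩, hxy⟩, rfl⟩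
  have h₂ : ((F ×ˢ G).filter fun p => p.1 ≤ p.2).image Prod.snd = G := by
    ext y
    simp only [Finset.mem_image, Finset.mem_filter, Finset.mem_product]
    refine ⟨fun ⟨p, hp, hpy⟩ => hpy ▸ hp.1.2, fun hy => ?_⟩
    obtain ⟨x, hx, hxy⟩ := h' y hy
    exact ⟨(x, y), ⟨⟨hx, hy⟩, hxy⟩, rfl⟩
  have hn : ((F ×ˢ G).filter fun p => p.1 ≤ p.2).Nonempty :=
    Finset.image_nonempty.1 (h₁.symm ▸ hF)
  rw [hB.join_image f Prod.fst hn hF h₁, hB.join_image f Prod.snd hn hG h₂]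
  exact hB.join_mono hn fun p hp => hf (Finset.mem_filter.1 hp).2

end Join

/-! ### Approximation by finite sets -/

section Approx

variable {X : Type u} [PartialOrder X] (hX : IsContinuousDcpo X)

open TopologicalSpace (Opens)

/-- The open set of all elements that `x` is way below. -/
def IsContinuousDcpo.wayAbove (x : X) : Opens X := ⟨{y | WayBelow x y}, hX.isOpen_wayAbove x⟩

/-- The open set of all elements that some element of `F` is way below. -/
def IsContinuousDcpo.wayAboveFinset (F : Finset X) : Opens X :=
  ⟨⋃ x ∈ F, {y | WayBelow x y}, isOpen_biUnion fun x _ => hX.isOpen_wayAbove x⟩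

theorem IsContinuousDcpo.mem_wayAboveFinset {F : Finset X} {y : X} :
    y ∈ hX.wayAboveFinset F ↔ ∃ x ∈ F, WayBelow x y := by
  change y ∈ ⋃ x ∈ F, {y | WayBelow x y} ↔ _
  simp

theorem IsContinuousDcpo.wayAboveFinset_mono {F G : Finset X} (h : F ⊆ G) :
    hX.wayAboveFinset F ≤ hX.wayAboveFinset G := fun y hy => by
  obtain ⟨x, hx, hxy⟩ := hX.mem_wayAboveFinset.1 hy
  exact hX.mem_wayAboveFinset.2 ⟨x, h hx, hxy⟩

/-- The finite set `F` is way below `φ` in the Egli–Milner sense. -/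
def FinBelow (F : Finset X) (φ : DoublePower X) : Prop :=
  (∀ x ∈ F, φ.Meets (hX.wayAbove x)) ∧ φ.Inside (hX.wayAboveFinset F)

/-- `φ` is approximated by the finite sets way below it. -/
def Approximable (φ : DoublePower X) : Prop :=
  ∀ (E : Finset X) (V : Opens X), (∀ x ∈ E, φ.Meets (hX.wayAbove x)) → φ.Inside V →
    ∃ F : Finset X, F.Nonempty ∧ FinBelow hX F φ ∧ (∀ x ∈ F, x ∈ V) ∧ ∀ x ∈ E, ∃ y ∈ F, x ≤ y

variable {hX}

theorem FinBelow.mono {F : Finset X} {φ ψ : DoublePower X} (h : FinBelow hX F φ) (hφ : φ ≤ ψ) :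
    FinBelow hX F ψ :=
  ⟨fun x hx => (h.1 x hx).mono hφ le_rfl, h.2.mono hφ le_rfl⟩

theorem FinBelow.op [DecidableEq X] {F G : Finset X} {φ ψ : DoublePower X} (h : FinBelow hX F φ)
    (h' : FinBelow hX G ψ) : FinBelow hX (F ∪ G) (φ ⋓ ψ) := by
  refine ⟨fun x hx => DoublePower.meets_op.2 ?_, DoublePower.inside_op.2 ⟨?_, ?_⟩⟩
  · exact (Finset.mem_union.1 hx).imp (h.1 x) (h'.1 x)
  · exact h.2.mono le_rfl (hX.wayAboveFinset_mono Finset.subset_union_left)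
  · exact h'.2.mono le_rfl (hX.wayAboveFinset_mono Finset.subset_union_right)

theorem exists_forall_meets {d : Set (DoublePower X)} (hn : d.Nonempty)
    (hd : DirectedOn (· ≤ ·) d) {φ : DoublePower X} (hφ : IsLUB d φ) {V : Opens X}
    (hV : φ.Inside V) (E : Finset X) (hE : ∀ x ∈ E, φ.Meets (hX.wayAbove x)) :
    ∃ ψ ∈ d, ψ.Inside V ∧ ∀ x ∈ E, ψ.Meets (hX.wayAbove x) := by
  classical
  induction E using Finset.induction_on with
  | empty =>
    obtain ⟨ψ, hψ, h⟩ := (DoublePower.inside_of_isLUB hn hd hφ).1 hV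
    exact ⟨ψ, hψ, h, by simp⟩
  | insert x E _ ih =>
    obtain ⟨ψ₁, hψ₁, hV₁, hE₁⟩ := ih fun z hz => hE z (Finset.mem_insert_of_mem hz)
    obtain ⟨ψ₂, hψ₂, h⟩ :=
      (DoublePower.meets_of_isLUB hn hd hφ).1 (hE x (Finset.mem_insert_self x E))
    obtain ⟨ψ, hψ, h₁, h₂⟩ := hd ψ₁ hψ₁ ψ₂ hψ₂
    refine ⟨ψ, hψ, hV₁.mono h₁ le_rfl, fun z hz => ?_⟩
    rcases Finset.mem_insert.1 hz with rfl | hz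
    · exact h.mono h₂ le_rfl
    · exact (hE₁ z hz).mono h₁ le_rfl

theorem FinBelow.exists_of_isLUB {d : Set (DoublePower X)} (hn : d.Nonempty)
    (hd : DirectedOn (· ≤ ·) d) {φ : DoublePower X} (hφ : IsLUB d φ) {F : Finset X}
    (h : FinBelow hX F φ) : ∃ ψ ∈ d, FinBelow hX F ψ :=
  let ⟨ψ, hψ, h₁, h₂⟩ := exists_forall_meets hn hd hφ h.2 F h.1
  ⟨ψ, hψ, h₂, h₁⟩

/-- Finite sets below a join are below joins of finite sets. -/
theorem Approximable.exists_op [DecidableEq X] {φ ψ : DoublePower X} (hφ : Approximable hX φ)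
    (hψ : Approximable hX ψ) {E : Finset X} {V : Opens X}
    (hE : ∀ x ∈ E, DoublePower.Meets (φ ⋓ ψ) (hX.wayAbove x)) (hV : DoublePower.Inside (φ ⋓ ψ) V) :
    ∃ F G : Finset X, F.Nonempty ∧ G.Nonempty ∧ FinBelow hX F φ ∧ FinBelow hX G ψ ∧
      (∀ x ∈ F ∪ G, x ∈ V) ∧ ∀ x ∈ E, ∃ y ∈ F ∪ G, x ≤ y := by
  classical
  have hV := DoublePower.inside_op.1 hV
  obtain ⟨F, hF, hFφ, hFV, hFE⟩ := hφ (E.filter fun x => φ.Meets (hX.wayAbove x)) V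
    (fun x hx => (Finset.mem_filter.1 hx).2) hV.1
  obtain ⟨G, hG, hGψ, hGV, hGE⟩ := hψ (E.filter fun x => ψ.Meets (hX.wayAbove x)) V
    (fun x hx => (Finset.mem_filter.1 hx).2) hV.2
  refine ⟨F, G, hF, hG, hFφ, hGψ, fun x hx => (Finset.mem_union.1 hx).elim (hFV x) (hGV x),
    fun x hx => ?_⟩
  rcases DoublePower.meets_op.1 (hE x hx) with h | h
  · obtain ⟨y, hy, hxy⟩ := hFE x (Finset.mem_filter.2 ⟨hx, h⟩)
    exact ⟨y, Finset.mem_union_left G hy, hxy⟩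
  · obtain ⟨y, hy, hxy⟩ := hGE x (Finset.mem_filter.2 ⟨hx, h⟩)
    exact ⟨y, Finset.mem_union_right F hy, hxy⟩

theorem approximable_eval (x : X) : Approximable hX ((eval X Heckmann).1 x) := by
  intro E V hE hV
  have hU : IsOpen ((V : Set X) ∩ ⋂ e ∈ E, {y | WayBelow e y}) :=
    V.isOpen.inter (E.finite_toSet.isOpen_biInter fun e _ => hX.isOpen_wayAbove e)
  have hx : x ∈ (V : Set X) ∩ ⋂ e ∈ E, {y | WayBelow e y} :=
    ⟨DoublePower.inside_eval.1 hV, Set.mem_iInter₂.2 fun e he => DoublePower.meets_eval.1 (hE e he)⟩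
  obtain ⟨z, ⟨hzV, hzE⟩, hzx⟩ := hX.exists_wayBelow_mem hU hx
  refine ⟨{z}, Finset.singleton_nonempty z, ⟨fun w hw => ?_, ?_⟩, fun w hw => ?_, fun e he =>
    ⟨z, Finset.mem_singleton_self z, WayBelow.le (Set.mem_iInter₂.1 hzE e he)⟩⟩
  · rw [Finset.mem_singleton.1 hw]
    exact DoublePower.meets_eval.2 hzx
  · exact DoublePower.inside_eval.2 (hX.mem_wayAboveFinset.2 ⟨z, Finset.mem_singleton_self z, hzx⟩)
  · rw [Finset.mem_singleton.1 hw]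
    exact hzV

/-- Approximable elements form a subalgebra: below a union, finite sets are united, and for a
directed supremum the finitely many conditions already hold at one member. -/
theorem approximable_of_mem_evalSub {φ : DoublePower X} (hφ : φ ∈ (evalSub X).carrier) :
    Approximable hX φ := by
  classical
  refine hφ { carrier := {φ | Approximable hX φ}, op_mem := ?_, sup_mem := ?_ } ?_
  · intro φ hφ ψ hψ E V hE hV
    obtain ⟨F, G, hF, hG, hFφ, hGψ, h, h'⟩ := Approximable.exists_op hφ hψ hE hV
    exact ⟨F ∪ G, hF.mono Finset.subset_union_left, hFφ.op hGψ, h, h'⟩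
  · intro d hd hn hdir φ hφ E V hE hV
    obtain ⟨ψ, hψ, hψV, hψE⟩ := exists_forall_meets hn hdir hφ hV E hE
    obtain ⟨F, hF, hFψ, h⟩ := hd hψ E V hψE hψV
    exact ⟨F, hF, hFψ.mono (hφ.1 hψ), h⟩
  · rintro _ ⟨x, rfl⟩
    exact approximable_eval x

end Approx

/-! ### The Plotkin powerdomain -/

section Plotkin

variable {X : Type u} [PartialOrder X]

/-- The extension at `φ` is the supremum of the joins of `f` over finite sets way below `φ`.
Approximability makes these joins directed, `FinBelow.exists_of_isLUB` gives continuity, and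
`Approximable.exists_op` gives one half of preservation of the operation. -/
theorem exists_hom_evalSub (hX : IsContinuousDcpo X) {B : Type v} [PartialOrder B] [DcpoAlgebra B]
    (hB : IsSemilattice B) (f : ContMap X B) :
    ∃ h : Hom (evalSub X).carrier B, ∀ x, h.1 ((evalSubMap X).1 x) = f.1 x := by
  classical
  have happ (φ : (evalSub X).carrier) : Approximable hX φ.1 := approximable_of_mem_evalSub φ.2
  have hhom (φ : (evalSub X).carrier) : φ.1 ∈ (hom01 X).carrier := evalSub_le_hom01 X φ.2
  set D : (evalSub X).carrier → Set B := fun φ =>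
    {b | ∃ (F : Finset X) (hF : F.Nonempty), FinBelow hX F φ.1 ∧ hB.join f.1 F hF = b} with hD
  have hDn (φ) : (D φ).Nonempty := by
    obtain ⟨F, hF, hFφ, _⟩ := happ φ ∅ ⊤ (by simp) (DoublePower.inside_top (hhom φ))
    exact ⟨_, F, hF, hFφ, rfl⟩
  have hDd (φ) : DirectedOn (· ≤ ·) (D φ) := by
    rintro _ ⟨F, hF, hFφ, rfl⟩ _ ⟨G, hG, hGφ, rfl⟩
    -- Taking `F ∪ G` as the set to dominate and the intersection of the two open neighbourhoods
    -- makes `K` an Egli–Milner upper bound of both `F` and `G`.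
    obtain ⟨K, hK, hKφ, hKV, hKE⟩ := happ φ (F ∪ G) _
      (fun x hx => (Finset.mem_union.1 hx).elim (hFφ.1 x) (hGφ.1 x))
      (DoublePower.inside_inf (hhom φ) hFφ.2 hGφ.2)
    refine ⟨_, ⟨K, hK, hKφ, rfl⟩, hB.join_le_join f.2.monotone hF hK
      (fun x hx => hKE x (Finset.mem_union_left G hx)) fun y hy => ?_,
      hB.join_le_join f.2.monotone hG hK
      (fun x hx => hKE x (Finset.mem_union_right F hx)) fun y hy => ?_⟩
    · obtain ⟨x, hx, hxy⟩ := hX.mem_wayAboveFinset.1 (hKV y hy).1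
      exact ⟨x, hx, hxy.le⟩
    · obtain ⟨x, hx, hxy⟩ := hX.mem_wayAboveFinset.1 (hKV y hy).2
      exact ⟨x, hx, hxy.le⟩
  choose h hh using fun φ => IsDcpo.exists_isLUB (D φ) (hDn φ) (hDd φ)
  have hjoin {φ : (evalSub X).carrier} {F : Finset X} (hF : F.Nonempty) (hFφ : FinBelow hX F φ.1) :
      hB.join f.1 F hF ≤ h φ := (hh φ).1 ⟨F, hF, hFφ, rfl⟩
  refine ⟨⟨h, ?_, fun φ ψ => le_antisymm ?_ ?_⟩, fun x => le_antisymm ?_ ?_⟩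
  · intro d hn hd φ hφ
    have hd' : DirectedOn (· ≤ ·) (Subtype.val '' d) := directedOn_image.2 (hd.mono fun _ _ h => h)
    refine ⟨?_, fun b hb => (hh φ).2 ?_⟩
    · rintro _ ⟨ψ, hψ, rfl⟩
      refine (hh ψ).2 ?_
      rintro _ ⟨F, hF, hFψ, rfl⟩
      exact hjoin hF (hFψ.mono (hφ.1 hψ))
    · rintro _ ⟨F, hF, hFφ, rfl⟩
      obtain ⟨_, ⟨ψ, hψ, rfl⟩, hFψ⟩ :=
        hFφ.exists_of_isLUB (hn.image _) hd' ((evalSub X).isLUB_coe hn hd hφ)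
      exact (hjoin hF hFψ).trans (hb ⟨ψ, hψ, rfl⟩)
  · refine (hh _).2 ?_
    rintro _ ⟨K, hK, hKφ, rfl⟩
    obtain ⟨F, G, hF, hG, hFφ, hGψ, hV, hE⟩ := Approximable.exists_op (happ φ) (happ ψ) hKφ.1 hKφ.2
    have hFG : (F ∪ G).Nonempty := hF.mono Finset.subset_union_left
    refine (hB.join_le_join f.2.monotone hK hFG hE fun y hy => ?_).trans ?_
    · obtain ⟨x, hx, hxy⟩ := hX.mem_wayAboveFinset.1 (hV y hy)
      exact ⟨x, hx, hxy.le⟩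
    · rw [hB.join_union f.1 hF hG]
      exact DcpoAlgebra.op_mono (hjoin hF hFφ) (hjoin hG hGψ)
  · refine (scottContinuous_op ScottContinuous.id (ScottContinuous.const (h ψ)) (hDn φ) (hDd φ)
      (hh φ)).2 ?_
    rintro _ ⟨_, ⟨F, hF, hFφ, rfl⟩, rfl⟩
    refine (scottContinuous_op (ScottContinuous.const _) ScottContinuous.id (hDn ψ) (hDd ψ)
      (hh ψ)).2 ?_
    rintro _ ⟨_, ⟨G, hG, hGψ, rfl⟩, rfl⟩
    have := hjoin (φ := φ ⋓ ψ) (hF.mono Finset.subset_union_left) (hFφ.op hGψ)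
    rwa [hB.join_union f.1 hF hG] at this
  · refine (hh _).2 ?_
    rintro _ ⟨F, hF, hFx, rfl⟩
    exact hB.join_le hF fun z hz => f.2.monotone (DoublePower.meets_eval.1 (hFx.1 z hz)).le
  · refine (f.2 (hX.2 x).1 (hX.2 x).2.1 (hX.2 x).2.2).2 ?_
    rintro _ ⟨z, hz, rfl⟩
    refine hjoin (Finset.singleton_nonempty z) ⟨fun w hw => ?_, ?_⟩
    · rw [Finset.mem_singleton.1 hw]
      exact DoublePower.meets_eval.2 hz
    · exact DoublePower.inside_eval.2 (hX.mem_wayAboveFinset.2 ⟨z, Finset.mem_singleton_self z, hz⟩)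

theorem isPlotkinPowerdomain_evalSubMap (hX : IsContinuousDcpo X) :
    IsPlotkinPowerdomain (evalSubMap X) := by
  refine ⟨isSemilattice_subAlgebra (isSemilattice_contMap Heckmann.isSemilattice) _, ?_⟩
  intro B _ _ hB f
  obtain ⟨h, hh⟩ := exists_hom_evalSub hX hB f
  refine ⟨h, hh, fun k hk => le_antisymm ?_ ?_⟩
  · refine SubAlgebra.hom_le_of_generated k h ?_
    rintro _ _ ⟨x, rfl⟩
    exact ((hk x).trans (hh x).symm).le
  · refine SubAlgebra.hom_le_of_generated h k ?_
    rintro _ _ ⟨x, rfl⟩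
    exact ((hk x).trans (hh x).symm).ge

/-- Free dcpo-semilattices over the same dcpo are isomorphic. -/
theorem IsPlotkinPowerdomain.exists_orderIso {P Q : Type u} [PartialOrder P] [PartialOrder Q]
    [DcpoAlgebra P] [DcpoAlgebra Q] {ι : ContMap X P} {κ : ContMap X Q}
    (hι : IsPlotkinPowerdomain ι) (hκ : IsPlotkinPowerdomain κ) :
    ∃ i : P ≃o Q, (∀ a b, i (a ⋓ b) = i a ⋓ i b) ∧ ∀ x, i (ι.1 x) = κ.1 x := by
  obtain ⟨g, hg, -⟩ := hι.2 Q hκ.1 κ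
  obtain ⟨h, hh, -⟩ := hκ.2 P hι.1 ι
  have hgh : ∀ a, h.1 (g.1 a) = a := fun a => by
    have : h.comp g = ⟨fun a => a, ScottContinuous.id, fun _ _ => rfl⟩ :=
      (hι.2 P hι.1 ι).unique (fun x => (congrArg h.1 (hg x)).trans (hh x)) fun _ => rfl
    exact congrArg (fun k : Hom P P => k.1 a) this
  have hhg : ∀ b, g.1 (h.1 b) = b := fun b => by
    have : g.comp h = ⟨fun b => b, ScottContinuous.id, fun _ _ => rfl⟩ :=
      (hκ.2 Q hκ.1 κ).unique (fun x => (congrArg g.1 (hh x)).trans (hg x)) fun _ => rfl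
    exact congrArg (fun k : Hom Q Q => k.1 b) this
  refine ⟨{ toFun := g.1, invFun := h.1, left_inv := hgh, right_inv := hhg,
            map_rel_iff' := fun {a b} => ⟨fun hab => ?_, fun hab => g.2.1.monotone hab⟩ },
    g.2.2, hg⟩
  have := h.2.1.monotone hab
  rwa [Equiv.coe_fn_mk, hgh, hgh] at this

end Plotkin

/-! ### A dcpo whose repletion is larger than its Plotkin powerdomain -/

/-- The two-point set with the discrete order. -/
inductive TwoPoint : Type u
  | left
  | right

namespace TwoPoint

instance : PartialOrder TwoPoint.{u} where
  le a b := a = b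
  lt _ _ := False
  lt_iff_le_not_ge _ _ := ⟨False.elim, fun h => h.2 h.1.symm⟩
  le_refl _ := rfl
  le_trans _ _ _ h h' := h.trans h'
  le_antisymm _ _ h _ := h

theorem le_iff {a b : TwoPoint.{u}} : a ≤ b ↔ a = b := Iff.rfl

instance : Finite TwoPoint.{u} :=
  Finite.of_surjective (fun b : Bool => cond b left right) fun
    | left => ⟨true, rfl⟩
    | right => ⟨false, rfl⟩

theorem isContinuousDcpo_twoPoint : IsContinuousDcpo TwoPoint.{u} := by
  have hmem {d : Set TwoPoint.{u}} (hd : DirectedOn (· ≤ ·) d) {x : TwoPoint.{u}}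
      (hx : x ∈ d) : IsGreatest d x :=
    ⟨hx, fun y hy => by
      obtain ⟨z, _, h₁, h₂⟩ := hd x hx y hy
      exact le_iff.2 ((le_iff.1 h₂).trans (le_iff.1 h₁).symm)⟩
  have hway (x y : TwoPoint.{u}) : WayBelow x y ↔ x = y := by
    refine ⟨fun h => le_iff.1 h.le, ?_⟩
    rintro rfl d ⟨z, hz⟩ hd a ha hxa
    exact ⟨z, hz, hxa.trans (ha.unique (hmem hd hz).isLUB).le⟩
  refine ⟨⟨fun d ⟨x, hx⟩ hd => ⟨x, (hmem hd hx).isLUB⟩⟩, fun x => ?_⟩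
  simp only [hway]
  exact ⟨⟨x, rfl⟩, by rintro _ rfl _ rfl; exact ⟨_, rfl, rfl, rfl⟩,
    (isGreatest_singleton (a := x)).isLUB⟩

/-- The formal lens `({left}, {left, right})`. -/
def leftLens : FormalLens TwoPoint.{u} where
  C := Set.Iic left
  Q := Set.univ
  isClosed := isScottClosed_Iic _
  isCompact := Set.finite_univ.isCompact
  saturated := isUpperSet_univ
  nonempty := ⟨left, Set.mem_Iic.2 le_rfl, Set.mem_univ left⟩

theorem evalSub_lt_hom01 : evalSub TwoPoint.{u} < hom01 TwoPoint.{u} := by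
  have hX := isContinuousDcpo_twoPoint.{u}
  have hL := leftLens.{u}.represents_toDoublePower
  refine lt_of_le_not_ge (evalSub_le_hom01 _) fun h => ?_
  -- A finite set way below this lens must contain `right` in order to cover `Q`, yet each of its
  -- members must be way below a point of `C`, whose only point is `left`.
  obtain ⟨F, _, ⟨hFC, hFQ⟩, -⟩ := approximable_of_mem_evalSub (hX := hX) (h hL.mem_hom01) ∅ ⊤
    (by simp) (DoublePower.inside_top hL.mem_hom01)
  have hin := ContMap.ofOpens_eq_top.1 ((hL _).2.1 hFQ right (Set.mem_univ right.{u}))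
  obtain ⟨x, hxF, hx⟩ := hX.mem_wayAboveFinset.1 hin
  obtain ⟨y, hy, hxy⟩ := (hL _).1.1 (hFC x hxF)
  have hxy : WayBelow x y := (ContMap.ofOpens_ne_bot.1 hxy).elim id False.elim
  have h₁ : x = right := le_iff.1 hx.le
  have h₂ : x = y := le_iff.1 hxy.le
  have h₃ : y = left := le_iff.1 (Set.mem_Iic.1 hy)
  simp [h₁, h₃] at h₂

end TwoPoint

end DomainTheory

theorem theorem4p3 :
    -- (a) `hom_{0,1}(A^X, A)` is the `A`-repletion of a Scott-compact continuous dcpo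
    (∀ (X : Type u) [PartialOrder X], IsContinuousDcpo X → ScottCompact X →
      IsLeast {S : SubAlgebra (DoublePower X) |
        IsCompleteAlgebra Heckmann S.carrier ∧ ∀ x, (eval X Heckmann).1 x ∈ S.carrier} (hom01 X) ∧
      IsLeast {S : SubAlgebra (DoublePower X) |
        IsWeaklyCompleteAlgebra Heckmann S.carrier ∧ ∀ x, (eval X Heckmann).1 x ∈ S.carrier}
        (hom01 X)) ∧
    -- its elements correspond to formal lenses
    (∀ (X : Type u) [PartialOrder X], IsContinuousDcpo X →
      ∃ i : (hom01 X).carrier ≃o FormalLens X,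
        (∀ φ, (i φ).Represents φ.1) ∧ ∀ φ ψ, i (φ ⋓ ψ) = (i φ).union (i ψ)) ∧
    -- (b) the Plotkin powerdomain of a continuous dcpo
    (∀ (X : Type u) [PartialOrder X], IsContinuousDcpo X →
      IsLeast {S : SubAlgebra (DoublePower X) | ∀ x, (eval X Heckmann).1 x ∈ S.carrier}
        (evalSub X) ∧
      IsPlotkinPowerdomain (evalSubMap X) ∧
      ∀ (P : Type u) [PartialOrder P] [DcpoAlgebra P] (ι : ContMap X P), IsPlotkinPowerdomain ι →
        ∃ i : P ≃o (evalSub X).carrier,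
          (∀ a b, i (a ⋓ b) = i a ⋓ i b) ∧ ∀ x, i (ι.1 x) = (evalSubMap X).1 x) ∧
    -- the Plotkin powerdomain is in general properly smaller than the repletion
    (∃ (X : Type u) (_ : PartialOrder X), IsContinuousDcpo X ∧ ScottCompact X ∧
      evalSub X < hom01 X) := by
  refine ⟨fun X _ hX _ => ⟨isLeast_complete_hom01 hX, isLeast_weaklyComplete_hom01 hX⟩,
    fun X _ hX => exists_orderIso_formalLens hX, fun X _ hX => ⟨⟨eval_mem_evalSub, ?_⟩,
      isPlotkinPowerdomain_evalSubMap hX, fun P _ _ ι hι =>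
        hι.exists_orderIso (isPlotkinPowerdomain_evalSubMap hX)⟩,
    TwoPoint, inferInstance, TwoPoint.isContinuousDcpo_twoPoint, ?_, TwoPoint.evalSub_lt_hom01⟩
  · rintro S hS a ha
    refine ha S ?_
    rintro _ ⟨x, rfl⟩
    exact hS x
  · exact @Finite.compactSpace _ (Topology.scott _ Set.univ) _
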